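/- \textbf{Model.} Let $n\ge 0$ be a number of asynchronous processes that communicate through shared registers and compare\&swap (CAS) objects; $\mathrm{CAS}(o,w)$ atomically replaces the content by $w$ and returns true if the content equals $o$, and otherwise returns false and changes nothing. In each step one process executes atomically one statement with at most one access to shared memory; the schedule is arbitrary, and a process may crash (stop taking steps) at any time. A process that has no pending operation may invoke any operation, $\textsc{enqueue}(v)$ with $v\in\mathbb Z$, or $\textsc{dequeue}()$. Initially no operation is pending. "New" nodes and locations were never allocated before (nothing is ever reused), and their initial content is arbitrary. \textbf{Shared objects.} A node has fields $\mathit{value}$ (an integer register), $\mathit{next}$ (a CAS object with a pointer to a node, or NULL) and $\mathit{flag}$ (a boolean register). A location is a register that stores NULL, $\bot$ or an integer. There are a node $I$ with arbitrary value, $\mathit{next}=\mathrm{NULL}$, $\mathit{flag}=1$; a location $D$ with arbitrary non-NULL content; a CAS object $\mathit{Tail}$, initially pointing to $I$; a CAS object $\mathit{Head}$ with three fields $\langle \mathit{ptr},\mathit{value},\mathit{addr}\rangle$, initially $\langle I, x, D\rangle$ with $x\neq\mathrm{NULL}$ arbitrary; a register $\mathit{AnnE}$, initially pointing to $I$; a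 register $\mathit{AnnD}$, initially pointing to $D$. \textbf{The algorithm.} $\textsc{enqueue}(v)$: read $r':=\mathit{AnnE}$; call $\textsc{trytoenqueue}(r')$, ignoring its result; let $r$ be a new node; write $r.\mathit{value}:=v$, $r.\mathit{next}:=\mathrm{NULL}$, $r.\mathit{flag}:=0$; while $\textsc{trytoenqueue}(r)=\mathbf{failed}$, write $\mathit{AnnE}:=r$; return $\mathbf{done}$. $\textsc{dequeue}()$: read $a':=\mathit{AnnD}$; if the content of $a'$ is NULL, call $\textsc{trytodequeue}(a')$, ignoring its result; let $a$ be a new location; write ${*a}:=\mathrm{NULL}$; repeat: $t:=\textsc{trytodequeue}(a)$, and if $t=\mathbf{failed}$ then write $\mathit{AnnD}:=a$; until $t\ne\mathbf{failed}$; return $t$. $\textsc{trytoenqueue}(r)$: read $T:=\mathit{Tail}$; read $N:=T.\mathit{next}$; if $r.\mathit{flag}=1$, then read $T:=\mathit{Tail}$ again, read $N:=T.\mathit{next}$ again, if $N\ne\mathrm{NULL}$ write $N.\mathit{flag}:=1$ and apply $\mathit{Tail}.\mathrm{CAS}(T,N)$, and return $\mathbf{done}$. Otherwise, if $N\neq\mathrm{NULL}$,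 write $N.\mathit{flag}:=1$, apply $\mathit{Tail}.\mathrm{CAS}(T,N)$ and return $\mathbf{failed}$. Otherwise apply $T.\mathit{next}.\mathrm{CAS}(\mathrm{NULL},r)$; if it succeeds, write $r.\mathit{flag}:=1$, apply $\mathit{Tail}.\mathrm{CAS}(T,r)$ and return $\mathbf{done}$; if not, return $\mathbf{failed}$. $\textsc{trytodequeue}(a)$: read $H:=\mathit{Head}$; read $T:=\mathit{Tail}$; write ${*(H.\mathit{addr})}:=H.\mathit{value}$; if the content of $a$ is not NULL, read it again and return it. Otherwise, if $H.\mathit{ptr}=T$, apply $\mathit{Head}.\mathrm{CAS}(H,\langle H.\mathit{ptr},\bot,a\rangle)$ and return $\bot$ if it succeeds. If $H.\mathit{ptr}\neq T$, read $N:=H.\mathit{ptr}.\mathit{next}$, read $v:=N.\mathit{value}$, apply $\mathit{Head}.\mathrm{CAS}(H,\langle N,v,a\rangle)$ and return $v$ if it succeeds. If the CAS fails, return $\mathbf{failed}$. \textbf{Theorem.} This queue algorithm is differentiated $2$-nonblocking (DNB$_2$): in every execution and for each operation type $\mathcal T\in\{\textsc{enqueue},\textsc{dequeue}\}$, if some process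 invokes an operation of type $\mathcal T$ and takes infinitely many steps without completing it, then at least two processes complete infinitely many operations of type $\mathcal T$. -/

import Mathlib

namespace DNBQueue

/-! ### Shared-object implementations, their executions, and the progress property -/

/-- What a single step of an asynchronous system does, as far as the implemented object is concerned:
it invokes an operation of type `T` (with its argument), completes an operation of type `T`
(with its result), or is an internal step of a pending operation. -/
inductive Action (Ty : Type) (Arg Res : Ty → Type) : Type
  | invoke (T : Ty) (x : Arg T)
  | complete (T : Ty) (y : Res T)
  | internal

/-- An implementation of a shared object for `n` asynchronous processes, as a labelled transition
system. `step p s a s'` means: from the configuration `s`, process `p` can take one atomic step, which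
is the action `a` and leads to the configuration `s'`. -/
structure Implementation (n : ℕ) (Ty : Type) (Arg Res : Ty → Type) : Type 1 where
  State : Type
  start : State → Prop
  step : Fin n → State → Action Ty Arg Res → State → Prop

/-- An infinite execution. The schedule `proc` is arbitrary: no fairness is assumed, and a process
may stop taking steps at any moment (crash). -/
structure Execution {n : ℕ} {Ty : Type} {Arg Res : Ty → Type}
    (I : Implementation n Ty Arg Res) : Type where
  state : ℕ → I.State
  proc : ℕ → Fin n
  act : ℕ → Action Ty Arg Res
  start_state : I.start (state 0)
  step_state : ∀ i, I.step (proc i) (state i) (act i) (state (i + 1))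

section
variable {n : ℕ} {Ty : Type} {Arg Res : Ty → Type} {I : Implementation n Ty Arg Res}

/-- The `i`-th step is the invocation of an operation of type `T` by process `p`. -/
def Execution.InvokesAt (e : Execution I) (p : Fin n) (T : Ty) (i : ℕ) : Prop :=
  e.proc i = p ∧ ∃ x, e.act i = .invoke T x

/-- The `i`-th step is the completion of an operation of type `T` by process `p`. -/
def Execution.CompletesAt (e : Execution I) (p : Fin n) (T : Ty) (i : ℕ) : Prop :=
  e.proc i = p ∧ ∃ y, e.act i = .complete T y

/-- Process `p` invokes an operation of type `T` and takes infinitely many steps without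
completing it. (A process has at most one pending operation, so an operation of type `T` that
is invoked at step `i` is completed by the first completion of type `T` by `p` after `i`.) -/
def Execution.StuckIn (e : Execution I) (p : Fin n) (T : Ty) : Prop :=
  ∃ i, e.InvokesAt p T i ∧ {j | e.proc j = p}.Infinite ∧ ∀ j, i < j → ¬ e.CompletesAt p T j

end

/-- Differentiated `k`-nonblocking: in every execution and for every operation type `T`, if some
process invokes an operation of type `T` and takes infinitely many steps without completing it, then
at least `k` processes complete infinitely many operations of type `T`. -/
def Implementation.DNB {n : ℕ} {Ty : Type} {Arg Res : Ty → Type}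
    (I : Implementation n Ty Arg Res) (k : ℕ) : Prop :=
  ∀ (e : Execution I) (T : Ty), (∃ p, e.StuckIn p T) →
    ∃ S : Finset (Fin n), k ≤ S.card ∧ ∀ q ∈ S, {i | e.CompletesAt q T i}.Infinite

/-! ### The shared memory of the queue -/

/-- The content of a location used by dequeuers: `NULL`, the special value `⊥` (the queue was
empty), or an element of the queue. -/
inductive DVal : Type
  | null
  | bot
  | elem (v : ℤ)

/-- A list node. Nodes are addressed by natural numbers; `next` is `none` for `NULL`. -/
structure Node : Type where
  value : ℤ
  next : Option ℕ
  flag : Bool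

/-- The record stored in the compare&swap object `g_Head`; `addr` is the address of a location. -/
structure Head : Type where
  ptr : ℕ
  value : DVal
  addr : ℕ

/-- The shared memory. Nodes and locations live in two separate address spaces; `nodeUsed` and
`locUsed` are the addresses that have been allocated (nothing is ever deallocated). -/
structure Shared : Type where
  node : ℕ → Node
  loc : ℕ → DVal
  tail : ℕ
  head : Head
  annE : ℕ
  annD : ℕ
  nodeUsed : Finset ℕ
  locUsed : Finset ℕ

namespace Shared

def setValue (s : Shared) (r : ℕ) (v : ℤ) : Shared :=
  { s with node := Function.update s.node r { s.node r with value := v } }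

def setNext (s : Shared) (r : ℕ) (x : Option ℕ) : Shared :=
  { s with node := Function.update s.node r { s.node r with next := x } }

def setFlag (s : Shared) (r : ℕ) (b : Bool) : Shared :=
  { s with node := Function.update s.node r { s.node r with flag := b } }

def setLoc (s : Shared) (a : ℕ) (d : DVal) : Shared :=
  { s with loc := Function.update s.loc a d }

/-- The memory after `g_Tail.CAS(old, new)`, whose boolean result the algorithm ignores. -/
def casTail (s : Shared) (old new : ℕ) : Shared :=
  if s.tail = old then { s with tail := new } else s

/-- The initial memory: node `0` is `g_Init_Node` and location `0` is `g_Init_DQ`. The content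
of memory that is not yet allocated is arbitrary. -/
def Initial (s : Shared) : Prop :=
  (s.node 0).next = none ∧ (s.node 0).flag = true ∧ s.loc 0 ≠ .null ∧
  s.tail = 0 ∧ s.head.ptr = 0 ∧ s.head.value ≠ .null ∧ s.head.addr = 0 ∧
  s.annE = 0 ∧ s.annD = 0 ∧ s.nodeUsed = {0} ∧ s.locUsed = {0}

end Shared

/-! ### The code of a process -/

inductive OpType : Type
  | enqueue
  | dequeue

abbrev OpArg : OpType → Type
  | .enqueue => ℤ
  | .dequeue => Unit

abbrev OpRes : OpType → Type
  | .enqueue => Unit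
  | .dequeue => DVal

abbrev QAction : Type := Action OpType OpArg OpRes

/-- Which call of `trytoenqueue` is being executed: the single call of the altruistic phase
of `enqueue(v)`, or a call of the selfish phase (for the own node). -/
inductive ECall : Type
  | help (v : ℤ)
  | own

/-- Which call of `trytodequeue` is being executed. -/
inductive DCall : Type
  | help
  | own

/-- The local state of a process: the next statement to be executed, with the local variables
that are still in use. Throughout, `r` and `a` are the arguments of `trytoenqueue` and
`trytodequeue` (in the selfish phase: the own node `l_Node` and the own location `l_addr`),
`t` is `l_Tail`, `x` or `m` is `l_next`, and `h` is `l_Head`. -/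
inductive Ctl : Type
  | idle
  -- enqueue(v)
  | enqReadAnn (v : ℤ)
  | enqAlloc (v : ℤ)
  | enqInitValue (v : ℤ) (r : ℕ)
  | enqInitNext (r : ℕ)
  | enqInitFlag (r : ℕ)
  | enqAnnounce (r : ℕ)
  | enqReturn
  -- trytoenqueue(r)
  | teReadTail (c : ECall) (r : ℕ)
  | teReadNext (c : ECall) (r t : ℕ)
  | teReadFlag (c : ECall) (r t : ℕ) (x : Option ℕ)
  | teRereadTail (c : ECall) (r : ℕ)
  | teRereadNext (c : ECall) (r t : ℕ)
  | teDoneSetFlag (c : ECall) (r t m : ℕ)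
  | teDoneCasTail (c : ECall) (r t m : ℕ)
  | teFailSetFlag (c : ECall) (r t m : ℕ)
  | teFailCasTail (c : ECall) (r t m : ℕ)
  | teLink (c : ECall) (r t : ℕ)
  | teLinkedSetFlag (c : ECall) (r t : ℕ)
  | teLinkedCasTail (c : ECall) (r t : ℕ)
  -- dequeue()
  | deqReadAnn
  | deqReadAnnLoc (l : ℕ)
  | deqAlloc
  | deqInitLoc (a : ℕ)
  | deqAnnounce (a : ℕ)
  | deqReturn (d : DVal)
  -- trytodequeue(a)
  | tdReadHead (c : DCall) (a : ℕ)
  | tdReadTail (c : DCall) (a : ℕ) (h : Head)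
  | tdWriteBack (c : DCall) (a : ℕ) (h : Head) (t : ℕ)
  | tdTestLoc (c : DCall) (a : ℕ) (h : Head) (t : ℕ)
  | tdReadLoc (c : DCall) (a : ℕ)
  | tdCasEmpty (c : DCall) (a : ℕ) (h : Head)
  | tdReadNext (c : DCall) (a : ℕ) (h : Head)
  | tdReadValue (c : DCall) (a : ℕ) (h : Head) (x : Option ℕ)
  | tdCas (c : DCall) (a : ℕ) (h : Head) (m : ℕ) (v : ℤ)

/-- Where control goes when `trytoenqueue(r)` returns **done**. -/
def ECall.done : ECall → Ctl
  | .help v => .enqAlloc v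
  | .own => .enqReturn

/-- Where control goes when `trytoenqueue(r)` returns **failed**. -/
def ECall.failed (r : ℕ) : ECall → Ctl
  | .help v => .enqAlloc v
  | .own => .enqAnnounce r

/-- Where control goes when `trytodequeue(a)` returns the value `d`. -/
def DCall.done (d : DVal) : DCall → Ctl
  | .help => .deqAlloc
  | .own => .deqReturn d

/-- Where control goes when `trytodequeue(a)` returns **failed**. -/
def DCall.failed (a : ℕ) : DCall → Ctl
  | .help => .deqAlloc
  | .own => .deqAnnounce a

/-- The atomic steps of a process. Every step makes at most one access to the shared memory;
tests of local variables and returns from the two `tryto…` procedures are part of the step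
that precedes them. -/
inductive LocalStep : Shared → Ctl → QAction → Shared → Ctl → Prop
  -- enqueue(v)
  | invokeEnq (s v) :
      LocalStep s .idle (.invoke .enqueue v) s (.enqReadAnn v)
  | enqReadAnn (s v) :
      LocalStep s (.enqReadAnn v) .internal s (.teReadTail (.help v) s.annE)
  | enqAlloc (s v) (r : ℕ) (fresh : r ∉ s.nodeUsed) :
      LocalStep s (.enqAlloc v) .internal { s with nodeUsed := insert r s.nodeUsed }
        (.enqInitValue v r)
  | enqInitValue (s v r) :
      LocalStep s (.enqInitValue v r) .internal (s.setValue r v) (.enqInitNext r)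
  | enqInitNext (s r) :
      LocalStep s (.enqInitNext r) .internal (s.setNext r none) (.enqInitFlag r)
  | enqInitFlag (s r) :
      LocalStep s (.enqInitFlag r) .internal (s.setFlag r false) (.teReadTail .own r)
  | enqAnnounce (s r) :
      LocalStep s (.enqAnnounce r) .internal { s with annE := r } (.teReadTail .own r)
  | enqReturn (s) :
      LocalStep s .enqReturn (.complete .enqueue ()) s .idle
  -- trytoenqueue(r)
  | teReadTail (s c r) :
      LocalStep s (.teReadTail c r) .internal s (.teReadNext c r s.tail)
  | teReadNext (s c r t) :
      LocalStep s (.teReadNext c r t) .internal s (.teReadFlag c r t (s.node t).next)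
  | teReadFlag_set (s c r t x) (hf : (s.node r).flag = true) :
      LocalStep s (.teReadFlag c r t x) .internal s (.teRereadTail c r)
  | teReadFlag_unset_some (s c r t m) (hf : (s.node r).flag = false) :
      LocalStep s (.teReadFlag c r t (some m)) .internal s (.teFailSetFlag c r t m)
  | teReadFlag_unset_none (s c r t) (hf : (s.node r).flag = false) :
      LocalStep s (.teReadFlag c r t none) .internal s (.teLink c r t)
  | teRereadTail (s c r) :
      LocalStep s (.teRereadTail c r) .internal s (.teRereadNext c r s.tail)
  | teRereadNext_some (s c r t m) (hx : (s.node t).next = some m) :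
      LocalStep s (.teRereadNext c r t) .internal s (.teDoneSetFlag c r t m)
  | teRereadNext_none (s c r t) (hx : (s.node t).next = none) :
      LocalStep s (.teRereadNext c r t) .internal s c.done
  | teDoneSetFlag (s c r t m) :
      LocalStep s (.teDoneSetFlag c r t m) .internal (s.setFlag m true) (.teDoneCasTail c r t m)
  | teDoneCasTail (s c r t m) :
      LocalStep s (.teDoneCasTail c r t m) .internal (s.casTail t m) c.done
  | teFailSetFlag (s c r t m) :
      LocalStep s (.teFailSetFlag c r t m) .internal (s.setFlag m true) (.teFailCasTail c r t m)
  | teFailCasTail (s c r t m) :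
      LocalStep s (.teFailCasTail c r t m) .internal (s.casTail t m) (c.failed r)
  | teLink_success (s c r t) (hx : (s.node t).next = none) :
      LocalStep s (.teLink c r t) .internal (s.setNext t (some r)) (.teLinkedSetFlag c r t)
  | teLink_failure (s c r t) (hx : (s.node t).next ≠ none) :
      LocalStep s (.teLink c r t) .internal s (c.failed r)
  | teLinkedSetFlag (s c r t) :
      LocalStep s (.teLinkedSetFlag c r t) .internal (s.setFlag r true) (.teLinkedCasTail c r t)
  | teLinkedCasTail (s c r t) :
      LocalStep s (.teLinkedCasTail c r t) .internal (s.casTail t r) c.done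
  -- dequeue()
  | invokeDeq (s) :
      LocalStep s .idle (.invoke .dequeue ()) s .deqReadAnn
  | deqReadAnn (s) :
      LocalStep s .deqReadAnn .internal s (.deqReadAnnLoc s.annD)
  | deqReadAnnLoc_null (s l) (hl : s.loc l = .null) :
      LocalStep s (.deqReadAnnLoc l) .internal s (.tdReadHead .help l)
  | deqReadAnnLoc_nonnull (s l) (hl : s.loc l ≠ .null) :
      LocalStep s (.deqReadAnnLoc l) .internal s .deqAlloc
  | deqAlloc (s) (a : ℕ) (fresh : a ∉ s.locUsed) :
      LocalStep s .deqAlloc .internal { s with locUsed := insert a s.locUsed } (.deqInitLoc a)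
  | deqInitLoc (s a) :
      LocalStep s (.deqInitLoc a) .internal (s.setLoc a .null) (.tdReadHead .own a)
  | deqAnnounce (s a) :
      LocalStep s (.deqAnnounce a) .internal { s with annD := a } (.tdReadHead .own a)
  | deqReturn (s) (d : DVal) :
      LocalStep s (.deqReturn d) (.complete .dequeue d) s .idle
  -- trytodequeue(a)
  | tdReadHead (s c a) :
      LocalStep s (.tdReadHead c a) .internal s (.tdReadTail c a s.head)
  | tdReadTail (s c a h) :
      LocalStep s (.tdReadTail c a h) .internal s (.tdWriteBack c a h s.tail)
  | tdWriteBack (s c a h t) :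
      LocalStep s (.tdWriteBack c a h t) .internal (s.setLoc h.addr h.value) (.tdTestLoc c a h t)
  | tdTestLoc_nonnull (s c a h t) (hl : s.loc a ≠ .null) :
      LocalStep s (.tdTestLoc c a h t) .internal s (.tdReadLoc c a)
  | tdTestLoc_null_empty (s c a h t) (hl : s.loc a = .null) (ht : h.ptr = t) :
      LocalStep s (.tdTestLoc c a h t) .internal s (.tdCasEmpty c a h)
  | tdTestLoc_null_nonempty (s c a h t) (hl : s.loc a = .null) (ht : h.ptr ≠ t) :
      LocalStep s (.tdTestLoc c a h t) .internal s (.tdReadNext c a h)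
  | tdReadLoc (s c a) :
      LocalStep s (.tdReadLoc c a) .internal s (c.done (s.loc a))
  | tdCasEmpty_success (s c a h) (hh : s.head = h) :
      LocalStep s (.tdCasEmpty c a h) .internal { s with head := ⟨h.ptr, .bot, a⟩ } (c.done .bot)
  | tdCasEmpty_failure (s c a h) (hh : s.head ≠ h) :
      LocalStep s (.tdCasEmpty c a h) .internal s (c.failed a)
  | tdReadNext (s c a h) :
      LocalStep s (.tdReadNext c a h) .internal s (.tdReadValue c a h (s.node h.ptr).next)
  | tdReadValue (s c a h m) :
      LocalStep s (.tdReadValue c a h (some m)) .internal s (.tdCas c a h m (s.node m).value)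
  /-- Dereferencing `NULL` would hang the process: it keeps taking steps without effect. -/
  | tdReadValue_hang (s c a h) :
      LocalStep s (.tdReadValue c a h none) .internal s (.tdReadValue c a h none)
  | tdCas_success (s c a h m v) (hh : s.head = h) :
      LocalStep s (.tdCas c a h m v) .internal { s with head := ⟨m, .elem v, a⟩ }
        (c.done (.elem v))
  | tdCas_failure (s c a h m v) (hh : s.head ≠ h) :
      LocalStep s (.tdCas c a h m v) .internal s (c.failed a)

/-- The queue algorithm for `n` processes. A configuration consists of the shared memory and
the local state of every process; initially no operation is pending. -/
def queue (n : ℕ) : Implementation n OpType OpArg OpRes where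
  State := Shared × (Fin n → Ctl)
  start σ := σ.1.Initial ∧ ∀ p, σ.2 p = .idle
  step p σ a σ' := ∃ c', LocalStep σ.1 (σ.2 p) a σ'.1 c' ∧ σ'.2 = Function.update σ.2 p c'

end DNBQueue

/-!
Both operations have the same shape. In the altruistic phase a process reads the announced token
(a node or a location) and calls `tryto…` once for it; in the selfish phase it calls `tryto…` for
its own fresh token until that succeeds, announcing the token after every failure. A token *wins*
when it is linked into the list, respectively when its address is installed in `Head`. The proof
treats the two types uniformly, through functions of `T : OpType`.

Safety. `MemInv` and `CtlInv` hold along every execution (`Execution.inv`), with the order of the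
list and the sets of initialised and of installed tokens as ghost state. Consequently a token wins
at most once (`Execution.WinsAt.unique`): a linked node with `flag = 0` is still the last one, and
an address that has been replaced in `Head` has a non-NULL location, so that `Head` never returns
to an earlier value. Moreover no process ever follows a NULL pointer.

Progress. Let `p` be stuck, and suppose that no process but `q` completes infinitely many
operations of type `T` (`Execution.exists_two_of_stuck`).

* Ranks decrease along an operation except when a token is announced. So the processes other than
  `q` are eventually in their selfish phase for good (`exists_not_early`), and `p` announces its
  token infinitely often (`StuckIn.exists_announce`).
* From then on new tokens are allocated by `q` only, and each of the finitely many old ones wins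
  at most once. Hence eventually all wins are steps of `q`.
* If from some point on only one process wins, then this process eventually does not fail any
  more, hence stops announcing (`OnlyWinner.not_announces_often`). Applied to `p`, this shows that
  there are infinitely many wins; applied to `q`, it shows that eventually the announced token is
  always an old one whose owner announces it infinitely often. Such a token is never settled
  (`flag = 1`, respectively a non-NULL location), since its owner would notice that and return.
* As there are infinitely many wins, `q` starts infinitely many operations. In the altruistic
  phase of such an operation it serves an old unsettled token, undisturbed, and therefore makes it
  win (`Trapped.step`). This contradicts that old tokens do not win any more.
-/

namespace DNBQueue

/-! ### Progress of a pending operation -/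

/-- The contribution of the kind of call to `rank`: altruistic calls come earlier in an operation,
hence have a higher rank. -/
def ECall.base : ECall → ℕ
  | .help _ => 30
  | .own => 0

/-- See `ECall.base`. -/
def DCall.base : DCall → ℕ
  | .help => 30
  | .own => 0

/-- A bound on the number of steps until the pending operation of type `T` completes or announces
its token. The rank is `70` if no operation of type `T` is pending, it is in `[30, 69]` in the
altruistic phase, which ends with the allocation of the token at rank `30`, and less than `30` in
the selfish phase. The announcement has rank `12`; all statements that can lead to it within a
selfish call of `tryto…`, and only these, have a rank in `[12, 17]`, apart from the common
beginning of the call. -/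
def rank : OpType → Ctl → ℕ
  | .enqueue, .enqReadAnn _ => 60
  | .enqueue, .enqAlloc _ => 30
  | .enqueue, .enqInitValue _ _ => 24
  | .enqueue, .enqInitNext _ => 23
  | .enqueue, .enqInitFlag _ => 22
  | .enqueue, .enqAnnounce _ => 12
  | .enqueue, .enqReturn => 0
  | .enqueue, .teReadTail c _ => c.base + 21
  | .enqueue, .teReadNext c _ _ => c.base + 20
  | .enqueue, .teReadFlag c _ _ _ => c.base + 19
  | .enqueue, .teLink c _ _ => c.base + 17
  | .enqueue, .teFailSetFlag c _ _ _ => c.base + 17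
  | .enqueue, .teFailCasTail c _ _ _ => c.base + 16
  | .enqueue, .teRereadTail c _ => c.base + 11
  | .enqueue, .teRereadNext c _ _ => c.base + 10
  | .enqueue, .teDoneSetFlag c _ _ _ => c.base + 9
  | .enqueue, .teDoneCasTail c _ _ _ => c.base + 8
  | .enqueue, .teLinkedSetFlag c _ _ => c.base + 7
  | .enqueue, .teLinkedCasTail c _ _ => c.base + 6
  | .dequeue, .deqReadAnn => 61
  | .dequeue, .deqReadAnnLoc _ => 60
  | .dequeue, .deqAlloc => 30
  | .dequeue, .deqInitLoc _ => 24
  | .dequeue, .deqAnnounce _ => 12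
  | .dequeue, .deqReturn _ => 0
  | .dequeue, .tdReadHead c _ => c.base + 21
  | .dequeue, .tdReadTail c _ _ => c.base + 20
  | .dequeue, .tdWriteBack c _ _ _ => c.base + 19
  | .dequeue, .tdTestLoc c _ _ _ => c.base + 18
  | .dequeue, .tdReadNext c _ _ => c.base + 17
  | .dequeue, .tdReadValue c _ _ _ => c.base + 16
  | .dequeue, .tdCas c _ _ _ _ => c.base + 15
  | .dequeue, .tdCasEmpty c _ _ => c.base + 15
  | .dequeue, .tdReadLoc c _ => c.base + 5
  | _, _ => 70

/-- The variant of `rank` for a process whose own token is settled: the statements that lead to a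
failure are moved above the beginning of a call, since no new call gets to them. -/
def settledRank (T : OpType) (c : Ctl) : ℕ :=
  if 12 ≤ rank T c ∧ rank T c ≤ 17 then rank T c + 10 else rank T c

/-- The process is in the altruistic phase of an operation of type `T`, allocation included. -/
def Early (T : OpType) (c : Ctl) : Prop := 29 < rank T c ∧ rank T c < 70

/-- The token of the process in the selfish phase of an operation of type `T`. -/
def own : OpType → Ctl → Option ℕ
  | .enqueue, .enqInitValue _ r => some r
  | .enqueue, .enqInitNext r => some r
  | .enqueue, .enqInitFlag r => some r
  | .enqueue, .enqAnnounce r => some r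
  | .enqueue, .teReadTail .own r => some r
  | .enqueue, .teReadNext .own r _ => some r
  | .enqueue, .teReadFlag .own r _ _ => some r
  | .enqueue, .teLink .own r _ => some r
  | .enqueue, .teFailSetFlag .own r _ _ => some r
  | .enqueue, .teFailCasTail .own r _ _ => some r
  | .enqueue, .teRereadTail .own r => some r
  | .enqueue, .teRereadNext .own r _ => some r
  | .enqueue, .teDoneSetFlag .own r _ _ => some r
  | .enqueue, .teDoneCasTail .own r _ _ => some r
  | .enqueue, .teLinkedSetFlag .own r _ => some r
  | .enqueue, .teLinkedCasTail .own r _ => some r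
  | .dequeue, .deqInitLoc a => some a
  | .dequeue, .deqAnnounce a => some a
  | .dequeue, .tdReadHead .own a => some a
  | .dequeue, .tdReadTail .own a _ => some a
  | .dequeue, .tdWriteBack .own a _ _ => some a
  | .dequeue, .tdTestLoc .own a _ _ => some a
  | .dequeue, .tdReadNext .own a _ => some a
  | .dequeue, .tdReadValue .own a _ _ => some a
  | .dequeue, .tdCas .own a _ _ _ => some a
  | .dequeue, .tdCasEmpty .own a _ => some a
  | .dequeue, .tdReadLoc .own a => some a
  | _, _ => none

/-- The local state in which a process is about to announce the token `r`. -/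
def announceCtl : OpType → ℕ → Ctl
  | .enqueue, r => .enqAnnounce r
  | .dequeue, a => .deqAnnounce a

/-- The tokens that have been allocated. -/
def used : OpType → Shared → Finset ℕ
  | .enqueue, s => s.nodeUsed
  | .dequeue, s => s.locUsed

/-- The announced token. -/
def ann : OpType → Shared → ℕ
  | .enqueue, s => s.annE
  | .dequeue, s => s.annD

/-- The mark from which the owner of a token learns that its operation has taken effect: the flag
of a node is set, respectively a location is not NULL. -/
def Settled : OpType → Shared → ℕ → Prop
  | .enqueue, s, r => (s.node r).flag = true
  | .dequeue, s, a => s.loc a ≠ .null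

/-- The next step of a process in the given local state makes the token `x` win. -/
def Wins : OpType → Shared → Ctl → ℕ → Prop
  | .enqueue, s, .teLink _ r t, x => x = r ∧ (s.node t).next = none
  | .dequeue, s, .tdCasEmpty _ a h, x => x = a ∧ s.head = h
  | .dequeue, s, .tdCas _ a h _ _, x => x = a ∧ s.head = h
  | _, _, _, _ => False

/-- The process is about to dereference NULL. -/
def Hangs : Ctl → Prop
  | .tdReadValue _ _ _ none => True
  | _ => False

section
variable {T : OpType} {s s' : Shared} {c c' : Ctl} {act : QAction} {x : ℕ}

theorem rank_step (h : LocalStep s c act s' c') (hc : rank T c < 70)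
    (hcomp : ∀ y, act ≠ .complete T y) (hann : ∀ x, c ≠ announceCtl T x) (hh : ¬ Hangs c) :
    rank T c' < rank T c := by
  cases T <;> cases h <;> (try rename ECall => k; cases k) <;> (try rename DCall => k; cases k) <;>
    simp_all [rank, ECall.base, DCall.base, announceCtl, Hangs, ECall.done, ECall.failed,
      DCall.done, DCall.failed]

/-- Only a completion starts the way through the operation anew. The truncated subtraction
identifies all ranks of the selfish phase. -/
theorem early_step (h : LocalStep s c act s' c')
    (hcomp : ∀ y, act ≠ .complete T y) :
    rank T c' - 29 ≤ rank T c - 29 := by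
  cases T <;> cases h <;> (try rename ECall => k; cases k) <;> (try rename DCall => k; cases k) <;>
    simp_all [rank, ECall.base, DCall.base, ECall.done, ECall.failed, DCall.done, DCall.failed]

/-- The owner of a settled token returns after a bounded number of steps. -/
theorem settledRank_step (h : LocalStep s c act s' c') (hc : own T c = some x)
    (hx : Settled T s x) (hh : ¬ Hangs c) :
    settledRank T c' < settledRank T c := by
  cases T <;> cases h <;> (try rename ECall => k; cases k) <;> (try rename DCall => k; cases k) <;>
    simp_all [settledRank, rank, own, Settled, ECall.base, DCall.base, Hangs,
      ECall.done, ECall.failed, DCall.done, DCall.failed]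

theorem own_step (h : LocalStep s c act s' c') (hc : own T c' = some x) :
    own T c = some x ∨ (Early T c ∧ x ∉ used T s ∧ x ∈ used T s') := by
  cases T <;> cases h <;> (try rename ECall => k; cases k) <;> (try rename DCall => k; cases k) <;>
    simp_all [rank, own, Early, used, ECall.base, DCall.base,
      ECall.done, ECall.failed, DCall.done, DCall.failed]

theorem used_step (h : LocalStep s c act s' c') :
    used T s ⊆ used T s' := by
  cases T <;> cases h <;> simp [used, Shared.setValue, Shared.setNext, Shared.setFlag,
    Shared.setLoc, Shared.casTail, apply_ite]

theorem used_step_eq (h : LocalStep s c act s' c') (hc : rank T c ≠ 30) :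
    used T s' = used T s := by
  cases T <;> cases h <;> simp_all [used, rank, Shared.setValue, Shared.setNext,
    Shared.setFlag, Shared.setLoc, Shared.casTail, apply_ite]

theorem ann_step (h : LocalStep s c act s' c') :
    (c = announceCtl T (ann T s')) ∨ (ann T s' = ann T s ∧ ∀ x, c ≠ announceCtl T x) := by
  cases T <;> cases h <;> simp_all [ann, announceCtl, Shared.setValue, Shared.setNext,
    Shared.setFlag, Shared.setLoc, Shared.casTail, apply_ite]

theorem own_announceCtl (T : OpType) (x : ℕ) : own T (announceCtl T x) = some x := by
  cases T <;> rfl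

theorem Wins.own_or_early (h : Wins T s c x) : own T c = some x ∨ Early T c := by
  cases T <;> cases c <;> (try rename ECall => k; cases k) <;> (try rename DCall => k; cases k) <;>
    simp_all [Wins, own, Early, rank, ECall.base, DCall.base]

theorem rank_lt_of_invoke (h : LocalStep s c act s' c') {y} (ha : act = .invoke T y) :
    rank T c' < 70 := by
  cases T <;> cases h <;> simp_all [rank]
end

/-! ### Ghost state and invariants -/

/-- Ghost state. `pos x` is the position of the node `x` in the list, counted from `1`, and `0` if
`x` has not been linked; `len` is the length of the list. The list starts at the initial node, and
dequeued nodes stay in it. A node or location is ready when its owner has initialised it, and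
`installed` is the set of all addresses that `Head` has ever contained. -/
structure Ghost : Type where
  pos : ℕ → ℕ
  len : ℕ
  nodeReady : Set ℕ
  installed : Set ℕ
  locReady : Set ℕ

open Classical in
/-- The effect on the ghost state of a step of a process in the given local state. -/
noncomputable def Ghost.next (g : Ghost) (s : Shared) : Ctl → Ghost
  | .enqInitFlag r => { g with nodeReady := insert r g.nodeReady }
  | .teLink _ r t => if (s.node t).next = none then
      { g with pos := Function.update g.pos r (g.len + 1), len := g.len + 1 } else g
  | .deqInitLoc a => { g with locReady := insert a g.locReady }
  | .tdCasEmpty _ a h => if s.head = h then { g with installed := insert a g.installed } else g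
  | .tdCas _ a h _ _ => if s.head = h then { g with installed := insert a g.installed } else g
  | _ => g

/-- The invariant that relates the shared memory to the ghost state. -/
structure MemInv (s : Shared) (g : Ghost) : Prop where
  pos_le : ∀ x, g.pos x ≤ g.len
  pos_inj : ∀ x y, g.pos x ≠ 0 → g.pos x = g.pos y → x = y
  ready_of_pos : ∀ x, g.pos x ≠ 0 → x ∈ g.nodeReady
  used_of_ready : ∀ x ∈ g.nodeReady, x ∈ s.nodeUsed
  next_of_lt : ∀ x, g.pos x ≠ 0 → g.pos x < g.len →
    ∃ y, (s.node x).next = some y ∧ g.pos y = g.pos x + 1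
  next_of_eq : ∀ x, g.pos x ≠ 0 → g.pos x = g.len → (s.node x).next = none
  next_of_unlinked : ∀ x ∈ g.nodeReady, g.pos x = 0 → (s.node x).next = none
  tail_pos : g.pos s.tail ≠ 0
  len_le : g.len ≤ g.pos s.tail + 1
  flag_of_le : ∀ x, g.pos x ≠ 0 → g.pos x ≤ g.pos s.tail → (s.node x).flag = true
  annE_ready : s.annE ∈ g.nodeReady
  head_pos : g.pos s.head.ptr ≠ 0
  head_le : g.pos s.head.ptr ≤ g.pos s.tail
  head_value : s.head.value ≠ .null
  head_installed : s.head.addr ∈ g.installed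
  locReady_of_installed : ∀ x ∈ g.installed, x ∈ g.locReady
  used_of_locReady : ∀ x ∈ g.locReady, x ∈ s.locUsed
  loc_of_installed : ∀ x ∈ g.installed, x ≠ s.head.addr → s.loc x ≠ .null
  annD_ready : s.annD ∈ g.locReady

/-- `h` is a former or the present content of `Head`. The field `eq_of_addr` says that the address
identifies it, which excludes the ABA problem. -/
structure HeadSeen (s : Shared) (g : Ghost) (h : Head) : Prop where
  value : h.value ≠ .null
  installed : h.addr ∈ g.installed
  eq_of_addr : h.addr = s.head.addr → h = s.head
  pos : g.pos h.ptr ≠ 0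
  pos_le : g.pos h.ptr ≤ g.pos s.tail

/-- What a process knows after it has found the location `a` to be NULL: if `Head` still contains
`h`, then `a` was never installed. -/
structure CanCas (s : Shared) (g : Ghost) (a : ℕ) (h : Head) : Prop where
  ready : a ∈ g.locReady
  seen : HeadSeen s g h
  saved : s.loc h.addr ≠ .null
  new : h = s.head → a ∉ g.installed

/-- `r` is a ready node, and `t` is a former or the present content of `Tail`. -/
structure TailSeen (s : Shared) (g : Ghost) (r t : ℕ) : Prop where
  ready : r ∈ g.nodeReady
  pos : g.pos t ≠ 0
  pos_le : g.pos t ≤ g.pos s.tail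

/-- The invariant that relates the local state of a process to the shared memory and the ghost
state. -/
def CtlInv (s : Shared) (g : Ghost) : Ctl → Prop
  | .enqInitValue _ r | .enqInitNext r => r ∉ g.nodeReady ∧ r ∈ s.nodeUsed
  | .enqInitFlag r => (r ∉ g.nodeReady ∧ r ∈ s.nodeUsed) ∧ (s.node r).next = none
  | .enqAnnounce r | .teReadTail _ r | .teRereadTail _ r => r ∈ g.nodeReady
  | .teReadNext _ r t | .teRereadNext _ r t => TailSeen s g r t
  | .teReadFlag _ r t x => TailSeen s g r t ∧ ∀ m, x = some m → (s.node t).next = some m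
  | .teDoneSetFlag _ r t m | .teFailSetFlag _ r t m =>
      TailSeen s g r t ∧ (s.node t).next = some m
  | .teDoneCasTail _ r t m | .teFailCasTail _ r t m =>
      TailSeen s g r t ∧ (s.node t).next = some m ∧ (s.node m).flag = true
  | .teLink _ r t => TailSeen s g r t ∧ (g.pos t = g.len → g.pos r = 0)
  | .teLinkedSetFlag _ r t => TailSeen s g r t ∧ (s.node t).next = some r
  | .teLinkedCasTail _ r t =>
      TailSeen s g r t ∧ (s.node t).next = some r ∧ (s.node r).flag = true
  | .deqReadAnnLoc a | .deqAnnounce a | .tdReadHead _ a | .tdReadLoc _ a => a ∈ g.locReady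
  | .deqInitLoc a => a ∉ g.locReady ∧ a ∈ s.locUsed
  | .tdReadTail _ a h => a ∈ g.locReady ∧ HeadSeen s g h
  | .tdWriteBack _ a h t => a ∈ g.locReady ∧ HeadSeen s g h ∧
      g.pos t ≤ g.pos s.tail ∧ g.pos h.ptr ≤ g.pos t
  | .tdTestLoc _ a h t => a ∈ g.locReady ∧ HeadSeen s g h ∧
      (g.pos t ≤ g.pos s.tail ∧ g.pos h.ptr ≤ g.pos t) ∧ s.loc h.addr ≠ .null
  | .tdCasEmpty _ a h => CanCas s g a h
  | .tdReadNext _ a h => CanCas s g a h ∧ g.pos h.ptr < g.pos s.tail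
  | .tdReadValue _ a h x => CanCas s g a h ∧ ∃ m, x = some m ∧ g.pos m ≠ 0 ∧
      g.pos m ≤ g.pos s.tail
  | .tdCas _ a h m _ => CanCas s g a h ∧ g.pos m ≠ 0 ∧ g.pos m ≤ g.pos s.tail
  | _ => True

/-- What a step of a process with local state `c` may change: everything that the invariants of
the other processes depend on is kept or grows. Uninitialised nodes and locations are not touched,
except by the process that has allocated them. -/
structure Evolves (c : Ctl) (s : Shared) (g : Ghost) (s' : Shared) (g' : Ghost) : Prop where
  pos_eq : ∀ x, g.pos x ≠ 0 → g'.pos x = g.pos x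
  pos_eq_of_len : g'.len = g.len → g'.pos = g.pos
  len_le : g.len ≤ g'.len
  tail_le : g.pos s.tail ≤ g'.pos s'.tail
  next_some : ∀ x y, g.pos x ≠ 0 → (s.node x).next = some y → (s'.node x).next = some y
  unready : ∀ x ∈ s.nodeUsed, x ∉ g.nodeReady → own .enqueue c ≠ some x →
    (s'.node x).next = (s.node x).next ∧ x ∉ g'.nodeReady
  nodeUsed : ∀ x ∈ s.nodeUsed, x ∈ s'.nodeUsed
  locUsed : ∀ x ∈ s.locUsed, x ∈ s'.locUsed
  nodeReady : ∀ x ∈ g.nodeReady, x ∈ g'.nodeReady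
  locReady : ∀ x ∈ g.locReady, x ∈ g'.locReady
  installed : ∀ x ∈ g.installed, x ∈ g'.installed
  flag : ∀ x ∈ g.nodeReady, (s.node x).flag = true → (s'.node x).flag = true
  loc : ∀ x ∈ g.locReady, s.loc x ≠ .null → s'.loc x ≠ .null
  unready_loc : ∀ x ∈ s.locUsed, x ∉ g.locReady → own .dequeue c ≠ some x → x ∉ g'.locReady
  head : (s'.head = s.head ∧ g'.installed = g.installed) ∨ s'.head.addr ∉ g.installed

section
variable {s s' : Shared} {g g' : Ghost} {c c' : Ctl} {act : QAction} {x : ℕ}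

theorem Evolves.refl (c : Ctl) (s : Shared) (g : Ghost) : Evolves c s g s g := by
  constructor <;> grind

theorem HeadSeen.mono {h : Head} (hh : HeadSeen s g h) (he : Evolves c s g s' g') :
    HeadSeen s' g' h := by
  obtain ⟨h1, h2, h3, h4, h5⟩ := hh
  have := he.head
  have := he.pos_eq
  have := he.tail_le
  have := he.installed
  constructor <;> grind

theorem CanCas.mono {a : ℕ} {h : Head} (hG : MemInv s g) (hh : CanCas s g a h)
    (he : Evolves c s g s' g') : CanCas s' g' a h := by
  obtain ⟨h1, h2, h3, h4⟩ := hh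
  have := hG.locReady_of_installed
  have := h2.installed
  have := he.head
  have := he.locReady
  have := he.loc
  refine ⟨by grind, h2.mono he, by grind, by grind⟩

theorem TailSeen.mono {r t : ℕ} (hh : TailSeen s g r t) (he : Evolves c s g s' g') :
    TailSeen s' g' r t := by
  obtain ⟨h1, h2, h3⟩ := hh
  have := he.tail_le
  have := he.nodeReady
  have := he.pos_eq
  constructor <;> grind

/-- A node that follows a linked node is the next one of the list. -/
theorem MemInv.next_spec (hG : MemInv s g) {t m : ℕ} (ht : g.pos t ≠ 0)
    (hn : (s.node t).next = some m) :
    g.pos t < g.len ∧ g.pos m = g.pos t + 1 ∧ m ∈ g.nodeReady := by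
  have := hG.next_of_eq t
  have := hG.next_of_lt t
  have := hG.pos_le t
  have := hG.ready_of_pos
  grind

/-- Steps of other processes preserve the local invariant. The process whose local state is `b`
does not take the step, hence shares no own token with the process that does. -/
theorem CtlInv.mono (hG : MemInv s g) (he : Evolves c s g s' g') {b : Ctl} (hb : CtlInv s g b)
    (hown : ∀ T x, own T b = some x → own T c ≠ some x) : CtlInv s' g' b := by
  have key1 := fun h : Head => @HeadSeen.mono _ _ _ _ _ h (he := he)
  have key2 := fun a (h : Head) => @CanCas.mono _ _ _ _ _ a h (he := he) (hG := hG)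
  have key3 := fun r t => @TailSeen.mono _ _ _ _ _ r t (he := he)
  have key4 := @MemInv.next_spec s g hG
  have hE := hown .enqueue
  have hD := hown .dequeue
  have h1 := he.nodeReady
  have h2 := he.locReady
  have h3 := he.unready
  have h4 := he.unready_loc
  have h5 := he.nodeUsed
  have h6 := he.locUsed
  have h7 := he.next_some
  have h8 := he.flag
  have h9 := he.loc
  have h10 := he.pos_eq
  have h11 := he.tail_le
  have h12 := he.pos_eq_of_len
  have h13 := he.len_le
  have h14 := hG.pos_le
  have h15 := hG.locReady_of_installed
  clear hown he
  generalize own .enqueue c = oE at *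
  generalize own .dequeue c = oD at *
  have f1 := @TailSeen.pos s g
  have f2 := @TailSeen.ready s g
  have f3 := @TailSeen.pos_le s g
  have f4 := @HeadSeen.pos s g
  have f5 := @CanCas.seen s g
  have f6 := @HeadSeen.installed s g
  cases b <;> simp only [CtlInv, own] at hb hE hD ⊢
  all_goals first | exact trivial | grind

/-! ### Preservation of the invariant on the memory -/

theorem MemInv.link {r t : ℕ} (hG : MemInv s g) (hx : (s.node t).next = none)
    (hT : TailSeen s g r t) (hr : g.pos r = 0) :
    MemInv (s.setNext t (some r))
     { g with pos := Function.update g.pos r (g.len + 1), len := g.len + 1 } := by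
  have h1 := hG.pos_le
  have h2 := hG.pos_inj
  have h3 := hG.ready_of_pos
  choose! nx h5 using hG.next_of_lt
  have h6 := hG.next_of_eq
  have h7 := hG.next_of_unlinked
  have h8 := hG.tail_pos
  have h9 := hG.len_le
  have h10 := hG.flag_of_le
  have h12 := hG.head_pos
  have h13 := hG.head_le
  have f1 := hT.pos
  have f2 := hT.ready
  have f3 := hT.pos_le
  have e : g.pos t = g.len := by grind
  have e1 : s.tail ≠ r := by grind
  have e2 : s.head.ptr ≠ r := by grind
  have e3 : t ≠ r := by grind
  refine ⟨?_, ?_, ?_, hG.used_of_ready, ?_, ?_, ?_, ?_, ?_, ?_, hG.annE_ready, ?_, ?_,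
    hG.head_value, hG.head_installed, hG.locReady_of_installed, hG.used_of_locReady,
    hG.loc_of_installed, hG.annD_ready⟩ <;>
    simp only [Shared.setNext, Function.update_apply, e1, e2, if_false] <;> clear hG
  case refine_2 =>
    intro x y hx hxy
    have := h1 x
    have := h1 y
    have := h2 x y
    grind
  all_goals grind

theorem MemInv.casTail {t m : ℕ} (hG : MemInv s g) (ht : g.pos t ≠ 0)
    (hn : (s.node t).next = some m) (hm : (s.node m).flag = true) : MemInv (s.casTail t m) g := by
  obtain ⟨h1, h2, -⟩ := hG.next_spec ht hn
  unfold Shared.casTail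
  split_ifs with h
  · have h3 := hG.pos_inj
    have h4 := hG.flag_of_le
    have h5 := hG.pos_le
    have h6 := hG.head_le
    have h7 := hG.len_le
    exact { hG with
      tail_pos := by grind
      len_le := by grind
      flag_of_le := by grind
      head_le := by grind }
  · exact hG

theorem MemInv.setFlag_true (hG : MemInv s g) (m : ℕ) : MemInv (s.setFlag m true) g := by
  unfold Shared.setFlag
  have h1 := hG.next_of_lt
  have h2 := hG.next_of_eq
  have h3 := hG.next_of_unlinked
  have h4 := hG.flag_of_le
  exact { hG with
    next_of_lt := by
      intro x hx hl
      obtain ⟨y, hy⟩ := h1 x hx hl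
      exact ⟨y, by grind [Function.update_apply]⟩
    next_of_eq := by grind [Function.update_apply]
    next_of_unlinked := by grind [Function.update_apply]
    flag_of_le := by grind [Function.update_apply] }

theorem MemInv.update_node {r : ℕ} (hG : MemInv s g) (hr : r ∉ g.nodeReady) (v : Node) :
    MemInv { s with node := Function.update s.node r v } g := by
  have h0 := hG.ready_of_pos r
  have h1 := hG.next_of_lt
  have h2 := hG.next_of_eq
  have h3 := hG.next_of_unlinked
  have h4 := hG.flag_of_le
  have key : ∀ x, g.pos x ≠ 0 → x ≠ r := by grind
  exact { hG with
    next_of_lt := by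
      intro x hx hl
      simpa [Function.update_apply, key x hx] using h1 x hx hl
    next_of_eq := by grind [Function.update_apply]
    next_of_unlinked := by grind [Function.update_apply]
    flag_of_le := by grind [Function.update_apply] }

theorem MemInv.setLoc {a : ℕ} {d : DVal} (hG : MemInv s g)
    (hd : d = .null → a ∉ g.installed) : MemInv (s.setLoc a d) g := by
  unfold Shared.setLoc
  have h1 := hG.loc_of_installed
  exact { hG with loc_of_installed := by grind [Function.update_apply] }

/-- The address that is replaced in `Head` has a non-NULL location, because the process that
replaces it has written there before. -/
theorem MemInv.install {a m : ℕ} {d : DVal} (hG : MemInv s g) (hc : CanCas s g a s.head)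
    (hm : g.pos m ≠ 0) (hl : g.pos m ≤ g.pos s.tail) (hd : d ≠ .null) :
    MemInv { s with head := ⟨m, d, a⟩ } { g with installed := insert a g.installed } := by
  have h1 := hc.saved
  have h2 := hc.ready
  have h3 := hG.loc_of_installed
  have h4 := hG.locReady_of_installed
  exact { hG with
    head_pos := hm
    head_le := hl
    head_value := hd
    head_installed := by simp
    locReady_of_installed := by grind
    loc_of_installed := by grind }

theorem MemInv.step (hG : MemInv s g) (hL : CtlInv s g c) (h : LocalStep s c act s' c') :
    MemInv s' (g.next s c) := by
  cases h
  case enqAlloc v r hr =>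
    exact { hG with used_of_ready := fun x hx => Finset.mem_insert_of_mem (hG.used_of_ready x hx) }
  case enqInitValue v r => exact hG.update_node hL.1 _
  case enqInitNext r => exact hG.update_node hL.1 _
  case enqInitFlag r =>
    have hG' := hG.update_node hL.1.1 { s.node r with flag := false }
    have h1 := hG.next_of_unlinked
    have h2 := hG.used_of_ready
    have h3 := hG.ready_of_pos
    exact { hG' with
      ready_of_pos := fun x hx => .inr (h3 x hx)
      used_of_ready := by rintro x (rfl | hx); exacts [hL.1.2, h2 x hx]
      next_of_unlinked := by
        rintro x (rfl | hx) h0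
        · simpa [Shared.setFlag] using hL.2
        · exact hG'.next_of_unlinked x hx h0
      annE_ready := .inr hG.annE_ready }
  case enqAnnounce r => exact { hG with annE_ready := hL }
  case teDoneSetFlag => exact hG.setFlag_true _
  case teDoneCasTail => exact hG.casTail hL.1.pos hL.2.1 hL.2.2
  case teFailSetFlag => exact hG.setFlag_true _
  case teFailCasTail => exact hG.casTail hL.1.pos hL.2.1 hL.2.2
  case teLink_success k r t hx =>
    rw [Ghost.next, if_pos hx]
    refine hG.link hx hL.1 (hL.2 ?_)
    have h1 := hG.next_of_lt t hL.1.pos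
    have h2 := hG.pos_le t
    grind
  case teLink_failure k r t hx =>
    rw [Ghost.next, if_neg hx]
    exact hG
  case teLinkedSetFlag => exact hG.setFlag_true _
  case teLinkedCasTail => exact hG.casTail hL.1.pos hL.2.1 hL.2.2
  case deqAlloc a ha =>
    exact { hG with
      used_of_locReady := fun x hx => Finset.mem_insert_of_mem (hG.used_of_locReady x hx) }
  case deqInitLoc a =>
    have hG' := hG.setLoc (a := a) (d := .null) fun _ h => hL.1 (hG.locReady_of_installed a h)
    exact { hG' with
      locReady_of_installed := fun x hx => .inr (hG.locReady_of_installed x hx)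
      used_of_locReady := by rintro x (rfl | hx); exacts [hL.2, hG.used_of_locReady x hx]
      annD_ready := .inr hG.annD_ready }
  case deqAnnounce a => exact { hG with annD_ready := hL }
  case tdWriteBack k a h t => exact hG.setLoc fun h0 => absurd h0 hL.2.1.value
  case tdCasEmpty_success k a h hh =>
    subst hh
    rw [Ghost.next, if_pos rfl]
    exact hG.install hL hG.head_pos hG.head_le (by simp)
  case tdCasEmpty_failure k a h hh =>
    rw [Ghost.next, if_neg hh]
    exact hG
  case tdCas_success k a h m v hh =>
    subst hh
    rw [Ghost.next, if_pos rfl]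
    exact hG.install hL.1 hL.2.1 hL.2.2 (by simp)
  case tdCas_failure k a h m v hh =>
    rw [Ghost.next, if_neg hh]
    exact hG
  all_goals exact hG

/-! ### Preservation of the invariant on the local states -/

set_option maxHeartbeats 1000000 in
theorem Evolves.of_step (hG : MemInv s g) (hL : CtlInv s g c) (h : LocalStep s c act s' c') :
    Evolves c s g s' (g.next s c) := by
  have hG' := hG.step hL h
  have h1 := hG.ready_of_pos
  have h2 := hG.used_of_ready
  have h3 := hG.locReady_of_installed
  have h4 := hG'.pos_le
  have key := @MemInv.next_spec s g hG
  cases h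
  case enqAlloc | enqAnnounce | deqAlloc | deqAnnounce => constructor <;> grind [Ghost.next]
  case teLink_success k r t hx =>
    have : g.pos r = 0 := hL.2 (by
      have h1 := hG.next_of_lt t hL.1.pos
      have h2 := hG.pos_le t
      grind)
    have := hL.1.ready
    have := hL.1.pos
    rw [Ghost.next, if_pos hx] at hG' ⊢
    unfold Shared.setNext at *
    have := hG.tail_pos
    clear hG hG'
    constructor <;> grind [Function.update_apply]
  case teLink_failure k r t hx =>
    rw [Ghost.next, if_neg hx]
    exact .refl ..
  case tdCasEmpty_success k a h hh =>
    have := hL.new hh.symm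
    rw [Ghost.next, if_pos hh]
    constructor <;> grind
  case tdCasEmpty_failure k a h hh =>
    rw [Ghost.next, if_neg hh]
    exact .refl ..
  case tdCas_success k a h m v hh =>
    have := hL.1.new hh.symm
    rw [Ghost.next, if_pos hh]
    constructor <;> grind
  case tdCas_failure k a h m v hh =>
    rw [Ghost.next, if_neg hh]
    exact .refl ..
  case tdWriteBack k a h t =>
    have := hL.2.1.value
    simp only [Ghost.next, Shared.setLoc]
    constructor <;> grind [Function.update_apply]
  case deqInitLoc a =>
    simp only [Ghost.next, Shared.setLoc, CtlInv] at *
    constructor <;> grind [Function.update_apply, own]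
  case enqInitValue | enqInitNext | enqInitFlag =>
    clear hG hG'
    simp only [Ghost.next, Shared.setValue, Shared.setNext, Shared.setFlag, CtlInv] at *
    constructor <;> grind [Function.update_apply, own]
  case teDoneSetFlag | teFailSetFlag | teLinkedSetFlag =>
    clear hG hG' h4
    simp only [Ghost.next, Shared.setFlag, CtlInv] at *
    constructor <;> grind [Function.update_apply]
  case teDoneCasTail | teFailCasTail | teLinkedCasTail =>
    have := key hL.1.pos hL.2.1
    simp only [Ghost.next, Shared.casTail, CtlInv] at *
    clear hG hG' h4
    constructor <;> grind
  all_goals exact .refl ..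

theorem MemInv.headSeen (hG : MemInv s g) : HeadSeen s g s.head :=
  ⟨hG.head_value, hG.head_installed, fun _ => rfl, hG.head_pos, hG.head_le⟩

theorem MemInv.tailSeen (hG : MemInv s g) (hr : x ∈ g.nodeReady) : TailSeen s g x s.tail :=
  ⟨hr, hG.tail_pos, le_rfl⟩

set_option maxHeartbeats 1000000 in
theorem CtlInv.step (hG : MemInv s g) (hL : CtlInv s g c) (h : LocalStep s c act s' c') :
    CtlInv s' (g.next s c) c' := by
  have he := Evolves.of_step hG hL h
  have hG' := hG.step hL h
  have h0 := hG.headSeen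
  have h0' := @MemInv.tailSeen s g
  have key := @MemInv.next_spec s g hG
  have h7 := fun h (hh : HeadSeen s g h) => hh.mono he
  have h8 := fun r t (hh : TailSeen s g r t) => hh.mono he
  have h9 := fun a h (hh : CanCas s g a h) => hh.mono hG he
  have e1 := he.nodeReady
  have e2 := he.locReady
  have e3 := he.pos_eq
  have e4 := he.tail_le
  have f0 := @TailSeen.ready s g
  have f8 := @CanCas.ready s g
  have h1 := hG.loc_of_installed
  have h2 := hG.flag_of_le
  have h3 := hG.pos_inj
  have f1 := @TailSeen.pos s g
  have f3 := @TailSeen.pos_le s g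
  have f4 := @HeadSeen.pos s g
  have f2 := @HeadSeen.pos_le s g
  have f5 := @HeadSeen.value s g
  have f6 := @HeadSeen.installed s g
  have f7 := @HeadSeen.eq_of_addr s g
  have i1 := hG.annE_ready
  have i2 := hG.annD_ready
  have i3 := hG.used_of_ready
  have i4 := hG.used_of_locReady
  have i5 := hG.head_pos
  have i6 := hG.head_le
  have i7 := hG.tail_pos
  have i8 := hG.next_of_lt
  have i9 := hG.next_of_eq
  have i10 := hG.pos_le
  cases h
  case enqInitValue => exact hL
  case enqInitNext => exact ⟨hL, by simp [Shared.setNext]⟩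
  case enqInitFlag => exact .inl rfl
  case teDoneSetFlag | teFailSetFlag | teLinkedSetFlag =>
    exact ⟨h8 _ _ hL.1, he.next_some _ _ hL.1.pos hL.2, by simp [Shared.setFlag]⟩
  case deqInitLoc => exact .inl rfl
  case teLink_success => exact ⟨h8 _ _ hL.1, by simp [Shared.setNext]⟩
  -- `h.ptr` precedes a former content of `Tail` in the list, so its `next` is not NULL.
  case tdReadNext k a h =>
    have hlt := hL.2
    have := hG.pos_le s.tail
    obtain ⟨m, hm, hm'⟩ := hG.next_of_lt h.ptr hL.1.seen.pos (by omega)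
    exact ⟨hL.1, m, hm, show g.pos m ≠ 0 by omega, show g.pos m ≤ g.pos s.tail by omega⟩
  -- If `r` is linked, it comes after `Tail` as its flag is not set, so `t` is not the last node.
  case teReadFlag_unset_none => grind [CtlInv, Ghost.next]
  case tdWriteBack =>
    simp only [CtlInv] at *
    refine ⟨he.locReady _ hL.1, h7 _ hL.2.1, ⟨hL.2.2.1, hL.2.2.2⟩, ?_⟩
    simpa [Shared.setLoc] using hL.2.1.value
  -- If `a` were installed and `Head` were still `h`, then `loc a` would be non-NULL: for
  -- `a = h.addr` by the preceding write, and otherwise because `a` has been replaced in `Head`.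
  case tdTestLoc_null_empty =>
    simp only [CtlInv] at *
    constructor <;> grind [Ghost.next]
  case tdTestLoc_null_nonempty =>
    simp only [CtlInv] at *
    refine ⟨?_, ?_⟩
    · constructor <;> grind [Ghost.next]
    · grind [Ghost.next]
  all_goals (try rename ECall => k; cases k) <;> (try rename DCall => k; cases k) <;>
      simp only [CtlInv, ECall.done, ECall.failed, DCall.done, DCall.failed] at hL ⊢
  all_goals grind [Ghost.next]

end

/-! ### Invariants along an execution -/

/-- In the initial ghost state the list consists of the initial node alone. -/
theorem Shared.Initial.memInv {s : Shared} (h : s.Initial) :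
    MemInv s ⟨fun x => if x = 0 then 1 else 0, 1, {0}, {0}, {0}⟩ := by
  obtain ⟨h1, h2, h3, h4, h5, h6, h7, h8, h9, h10, h11⟩ := h
  constructor <;> grind

namespace Execution
variable {n : ℕ} (e : Execution (queue n)) {T : OpType} {i j : ℕ} {p q : Fin n} {x : ℕ}

/-- The shared memory before step `i`. -/
def mem (i : ℕ) : Shared := (show Shared × (Fin n → Ctl) from e.state i).1

/-- The local state of `p` before step `i`. -/
def ctl (i : ℕ) (p : Fin n) : Ctl := (show Shared × (Fin n → Ctl) from e.state i).2 p

/-- The ghost state before step `i`. -/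
noncomputable def ghost : ℕ → Ghost
  | 0 => ⟨fun x => if x = 0 then 1 else 0, 1, {0}, {0}, {0}⟩
  | i + 1 => (ghost i).next (e.mem i) (e.ctl i (e.proc i))

theorem initial : (e.mem 0).Initial := e.start_state.1

theorem ctl_zero (p : Fin n) : e.ctl 0 p = .idle := e.start_state.2 p

theorem localStep (i : ℕ) :
    LocalStep (e.mem i) (e.ctl i (e.proc i)) (e.act i) (e.mem (i + 1))
      (e.ctl (i + 1) (e.proc i)) := by
  obtain ⟨c', h, h'⟩ := e.step_state i
  have : e.ctl (i + 1) (e.proc i) = c' := by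
    unfold ctl
    exact (congrFun h' (e.proc i)).trans (by simp)
  rw [this]
  exact h

theorem ctl_of_ne (h : p ≠ e.proc i) : e.ctl (i + 1) p = e.ctl i p := by
  obtain ⟨c', -, h'⟩ := e.step_state i
  exact (congrFun h' p).trans (by simp [h, ctl])

theorem own_mem_used (h : own T (e.ctl i p) = some x) : x ∈ used T (e.mem i) := by
  induction i with
  | zero => rw [ctl_zero] at h; cases T <;> cases h
  | succ i ih =>
    by_cases hp : p = e.proc i
    · subst hp
      obtain h' | ⟨-, -, h'⟩ := own_step (e.localStep i) h
      · exact used_step (e.localStep i) (ih h')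
      · exact h'
    · exact used_step (e.localStep i) (ih (e.ctl_of_ne hp ▸ h))

/-- Allocation yields an unused token, so different processes own different tokens. -/
theorem own_inj (hp : own T (e.ctl i p) = some x) (hq : own T (e.ctl i q) = some x) : p = q := by
  induction i with
  | zero => rw [ctl_zero] at hp; cases T <;> cases hp
  | succ i ih =>
    have key : ∀ r, own T (e.ctl (i + 1) r) = some x →
        own T (e.ctl i r) = some x ∨ r = e.proc i ∧ x ∉ used T (e.mem i) := by
      intro r hr
      by_cases h : r = e.proc i
      · subst h
        exact (own_step (e.localStep i) hr).imp_right fun h => ⟨rfl, h.2.1⟩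
      · exact .inl (e.ctl_of_ne h ▸ hr)
    rcases key p hp with h1 | ⟨h1, h2⟩ <;> rcases key q hq with h3 | ⟨h3, h4⟩
    · exact ih h1 h3
    · exact absurd (e.own_mem_used h1) h4
    · exact absurd (e.own_mem_used h3) h2
    · rw [h1, h3]

theorem inv (i : ℕ) :
    MemInv (e.mem i) (e.ghost i) ∧ ∀ p, CtlInv (e.mem i) (e.ghost i) (e.ctl i p) := by
  induction i with
  | zero => exact ⟨e.initial.memInv, fun p => by rw [ctl_zero]; exact trivial⟩
  | succ i ih =>
    refine ⟨ih.1.step (ih.2 _) (e.localStep i), fun p => ?_⟩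
    by_cases hp : p = e.proc i
    · subst hp
      exact .step ih.1 (ih.2 _) (e.localStep i)
    · rw [e.ctl_of_ne hp]
      exact (ih.2 p).mono ih.1 (.of_step ih.1 (ih.2 _) (e.localStep i)) fun T x h h' =>
        hp (e.own_inj h h')

theorem memInv (i : ℕ) : MemInv (e.mem i) (e.ghost i) := (e.inv i).1

theorem ctlInv (i : ℕ) (p : Fin n) : CtlInv (e.mem i) (e.ghost i) (e.ctl i p) := (e.inv i).2 p

theorem evolves (i : ℕ) :
    Evolves (e.ctl i (e.proc i)) (e.mem i) (e.ghost i) (e.mem (i + 1)) (e.ghost (i + 1)) :=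
  .of_step (e.memInv i) (e.ctlInv i _) (e.localStep i)

theorem not_hangs (i : ℕ) (p : Fin n) : ¬ Hangs (e.ctl i p) := by
  intro h
  have := e.ctlInv i p
  unfold Hangs at h
  split at h
  · rename_i h'
    rw [h'] at this
    simp [CtlInv] at this
  · exact h

end Execution

/-- The token has been initialised. -/
def Ready : OpType → Ghost → ℕ → Prop
  | .enqueue, g, r => r ∈ g.nodeReady
  | .dequeue, g, a => a ∈ g.locReady

/-- The token has won. -/
def Won : OpType → Ghost → ℕ → Prop
  | .enqueue, g, r => g.pos r ≠ 0
  | .dequeue, g, a => a ∈ g.installed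

section
variable {T : OpType} {s s' : Shared} {g g' : Ghost} {c : Ctl} {x : ℕ}

theorem Evolves.settled (h : Evolves c s g s' g') (hr : Ready T g x) (hs : Settled T s x) :
    Settled T s' x := by
  cases T
  · exact h.flag x hr hs
  · exact h.loc x hr hs

theorem Evolves.ready (h : Evolves c s g s' g') (hr : Ready T g x) : Ready T g' x := by
  cases T
  · exact h.nodeReady x hr
  · exact h.locReady x hr

theorem Evolves.won (h : Evolves c s g s' g') (hw : Won T g x) : Won T g' x := by
  cases T
  · exact (h.pos_eq x hw).trans_ne hw
  · exact h.installed x hw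

theorem MemInv.mem_used_of_ready (hG : MemInv s g) (hr : Ready T g x) : x ∈ used T s := by
  cases T
  · exact hG.used_of_ready x hr
  · exact hG.used_of_locReady x hr

theorem CtlInv.ready_of_wins (hL : CtlInv s g c) (h : Wins T s c x) : Ready T g x := by
  cases T <;> cases c <;> simp only [Wins] at h
  · exact h.1 ▸ hL.1.ready
  · exact h.1 ▸ hL.ready
  · exact h.1 ▸ hL.1.ready

theorem CtlInv.not_won_of_wins (hG : MemInv s g) (hL : CtlInv s g c) (h : Wins T s c x) :
    ¬ Won T g x ∧ Won T (g.next s c) x := by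
  cases T <;> cases c <;> simp only [Wins] at h
  · obtain ⟨rfl, h⟩ := h
    have h1 := hG.next_of_lt _ hL.1.pos
    have h2 := hG.pos_le
    have := hL.2
    have h0 : g.pos x = 0 := by grind
    simp [Ghost.next, Won, h, h0]
  · obtain ⟨rfl, h⟩ := h
    have := hL.new h.symm
    simp_all [Ghost.next, Won]
  · obtain ⟨rfl, h⟩ := h
    have := hL.1.new h.symm
    simp_all [Ghost.next, Won]

end

namespace Execution
variable {n : ℕ} (e : Execution (queue n)) {T : OpType} {i j : ℕ} {p q : Fin n} {x : ℕ}

/-- The token `x` wins in step `i`. -/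
def WinsAt (T : OpType) (i x : ℕ) : Prop := Wins T (e.mem i) (e.ctl i (e.proc i)) x

/-- In step `i` process `p` announces the token `x`. -/
def AnnouncesAt (T : OpType) (p : Fin n) (i x : ℕ) : Prop :=
  e.proc i = p ∧ e.ctl i p = announceCtl T x

theorem ready_mono (hij : i ≤ j) (h : Ready T (e.ghost i) x) : Ready T (e.ghost j) x :=
  Nat.le_induction h (fun k _ hk => (e.evolves k).ready hk) j hij

theorem won_mono (hij : i ≤ j) (h : Won T (e.ghost i) x) : Won T (e.ghost j) x :=
  Nat.le_induction h (fun k _ hk => (e.evolves k).won hk) j hij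

theorem settled_mono (hij : i ≤ j) (hr : Ready T (e.ghost i) x) (h : Settled T (e.mem i) x) :
    Settled T (e.mem j) x :=
  Nat.le_induction h (fun k hk hs => (e.evolves k).settled (e.ready_mono hk hr) hs) j hij

theorem WinsAt.mem_used (h : e.WinsAt T i x) : x ∈ used T (e.mem i) :=
  (e.memInv i).mem_used_of_ready ((e.ctlInv i _).ready_of_wins h)

theorem WinsAt.unique (hi : e.WinsAt T i x) (hj : e.WinsAt T j x) : i = j := by
  wlog h : i < j generalizing i j
  · by_contra hne
    exact hne (this hj hi (by omega)).symm
  · have h1 := (CtlInv.not_won_of_wins (e.memInv i) (e.ctlInv i _) hi).2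
    have h2 := (CtlInv.not_won_of_wins (e.memInv j) (e.ctlInv j _) hj).1
    exact absurd (e.won_mono (i := i + 1) h h1) h2

/-- As a token wins at most once, finitely many tokens win finitely often. -/
theorem finite_wins (T : OpType) (U : Finset ℕ) : ∃ N, ∀ i ≥ N, ∀ x ∈ U, ¬ e.WinsAt T i x := by
  have : {i | ∃ x ∈ U, e.WinsAt T i x}.Finite := by
    have : {i | ∃ x ∈ U, e.WinsAt T i x} = ⋃ x ∈ U, {i | e.WinsAt T i x} := by ext; simp
    rw [this]
    exact U.finite_toSet.biUnion fun x _ =>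
      Set.Subsingleton.finite fun i hi j hj => WinsAt.unique e hi hj
  obtain ⟨N, hN⟩ := this.bddAbove
  exact ⟨N + 1, fun i hi x hx h => absurd (hN ⟨x, hx, h⟩) (by omega)⟩

end Execution

/-! ### A process that nobody disturbs -/

/-- What is true of the local state of a process as long as nobody else wins, once it has found
the shared memory in order. For `enqueue`: `Tail` points to the last node, except between the
linking of a node by the process itself and its update of `Tail`, and what the process has read is
up to date. For `dequeue`: the process has read the present content of `Head`. No failure occurs
in such a state. -/
def Undisturbed : OpType → Shared → Ghost → Ctl → Prop
  | .enqueue, _, g, .teLinkedSetFlag _ _ t | .enqueue, _, g, .teLinkedCasTail _ _ t =>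
      g.pos t + 1 = g.len
  | .enqueue, s, g, .teReadNext _ _ t | .enqueue, s, g, .teRereadNext _ _ t
  | .enqueue, s, g, .teLink _ _ t => g.pos s.tail = g.len ∧ g.pos t = g.len
  | .enqueue, s, g, .teReadFlag _ _ t x => g.pos s.tail = g.len ∧ g.pos t = g.len ∧ x = none
  | .enqueue, _, _, .teDoneSetFlag _ _ _ _ | .enqueue, _, _, .teDoneCasTail _ _ _ _
  | .enqueue, _, _, .teFailSetFlag _ _ _ _ | .enqueue, _, _, .teFailCasTail _ _ _ _
  | .enqueue, _, _, .enqAnnounce _ => False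
  | .enqueue, s, g, _ => g.pos s.tail = g.len
  | .dequeue, s, _, .tdReadTail _ _ h | .dequeue, s, _, .tdWriteBack _ _ h _
  | .dequeue, s, _, .tdTestLoc _ _ h _ | .dequeue, s, _, .tdCasEmpty _ _ h
  | .dequeue, s, _, .tdReadNext _ _ h | .dequeue, s, _, .tdReadValue _ _ h _
  | .dequeue, s, _, .tdCas _ _ h _ _ => h = s.head
  | .dequeue, _, _, .deqAnnounce _ => False
  | .dequeue, _, _, _ => True

/-- What is true of the local state of a process as long as nobody else wins, and after one
announcement. For `enqueue`, `Tail` may still lag behind by one node; a failing call corrects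
this. -/
def NearlyUndisturbed : OpType → Shared → Ghost → Ctl → Prop
  | .enqueue, _, g, .teLinkedSetFlag _ _ t | .enqueue, _, g, .teLinkedCasTail _ _ t =>
      g.pos t + 1 = g.len
  | .enqueue, _, g, .teReadNext _ _ t | .enqueue, _, g, .teFailSetFlag _ _ t _
  | .enqueue, _, g, .teFailCasTail _ _ t _ => g.len ≤ g.pos t + 1
  | .enqueue, _, g, .teReadFlag _ _ t x => g.len ≤ g.pos t + 1 ∧ (x = none → g.pos t = g.len)
  | .enqueue, _, g, .teLink _ _ t => g.pos t = g.len
  | .enqueue, s, g, .enqAnnounce _ => g.pos s.tail = g.len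
  | _, _, _, _ => True

/-- If the process is in the altruistic phase of an operation of type `T`, then it is serving a
token in `B`, and the call has not got to the point where it can return. -/
def Trapped (B : ℕ → Prop) : OpType → Ctl → Prop
  | .enqueue, .teReadTail (.help _) r | .enqueue, .teReadNext (.help _) r _
  | .enqueue, .teReadFlag (.help _) r _ _ | .enqueue, .teLink (.help _) r _ => B r
  | .enqueue, .teRereadTail (.help _) _ | .enqueue, .teRereadNext (.help _) _ _
  | .enqueue, .teDoneSetFlag (.help _) _ _ _ | .enqueue, .teDoneCasTail (.help _) _ _ _
  | .enqueue, .teFailSetFlag (.help _) _ _ _ | .enqueue, .teFailCasTail (.help _) _ _ _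
  | .enqueue, .teLinkedSetFlag (.help _) _ _ | .enqueue, .teLinkedCasTail (.help _) _ _
  | .enqueue, .enqAlloc _ => False
  | .dequeue, .deqReadAnnLoc a | .dequeue, .tdReadHead .help a | .dequeue, .tdReadTail .help a _
  | .dequeue, .tdWriteBack .help a _ _ | .dequeue, .tdTestLoc .help a _ _
  | .dequeue, .tdCasEmpty .help a _ | .dequeue, .tdReadNext .help a _
  | .dequeue, .tdReadValue .help a _ _ | .dequeue, .tdCas .help a _ _ _ => B a
  | .dequeue, .tdReadLoc .help _ | .dequeue, .deqAlloc => False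
  | _, _ => True

/-- No token of type `T` has won between the two configurations. -/
def NoWin : OpType → Shared → Ghost → Shared → Ghost → Prop
  | .enqueue, _, g, _, g' => g'.len = g.len
  | .dequeue, s, _, s', _ => s'.head = s.head

section
variable {T : OpType} {s s' : Shared} {g g' : Ghost} {b c c' : Ctl} {act : QAction} {x : ℕ}
  {B : ℕ → Prop}

theorem NoWin.of_step (h : LocalStep s c act s' c') (hw : ∀ x, ¬ Wins T s c x) :
    NoWin T s g s' (g.next s c) := by
  cases T <;> cases h <;> simp_all [NoWin, Ghost.next, Wins, Shared.setValue, Shared.setNext,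
    Shared.setFlag, Shared.setLoc, Shared.casTail, apply_ite]

/-- A link is appended at the end of the list. -/
theorem CtlInv.link {k : ECall} {r t : ℕ} (hG : MemInv s g) (hL : CtlInv s g (.teLink k r t))
    (hx : (s.node t).next = none) :
    (g.next s (.teLink k r t)).pos t + 1 = (g.next s (.teLink k r t)).len := by
  have h1 := hG.next_of_lt t hL.1.pos
  have h2 := hG.pos_le t
  have h3 := hL.1.pos
  have h4 := hL.2
  rw [Ghost.next, if_pos hx]
  grind [Function.update_apply]

theorem Undisturbed.mono (hG' : MemInv s' g') (he : Evolves c s g s' g')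
    (hq : NoWin T s g s' g') (hb : Undisturbed T s g b) : Undisturbed T s' g' b := by
  cases T
  · have h1 := he.pos_eq_of_len hq
    have h2 := he.tail_le
    have h3 := hG'.pos_le s'.tail
    have h4 : g'.len = g.len := hq
    cases b <;> simp only [Undisturbed, h1, h4] at hb h2 h3 ⊢ <;> grind
  · have h1 : s'.head = s.head := hq
    cases b <;> simp only [Undisturbed, h1] at hb ⊢ <;> exact hb

theorem NearlyUndisturbed.mono (hG' : MemInv s' g') (he : Evolves c s g s' g')
    (hq : NoWin T s g s' g') (hb : NearlyUndisturbed T s g b) : NearlyUndisturbed T s' g' b := by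
  cases T
  · have h1 := he.pos_eq_of_len hq
    have h2 := he.tail_le
    have h3 := hG'.pos_le s'.tail
    have h4 : g'.len = g.len := hq
    cases b <;> simp only [NearlyUndisturbed, h1, h4] at hb h2 h3 ⊢ <;> grind
  · cases b <;> trivial

theorem Undisturbed.step (hG : MemInv s g) (hL : CtlInv s g c) (h : LocalStep s c act s' c')
    (hc : Undisturbed T s g c) : Undisturbed T s' (g.next s c) c' := by
  have key := @MemInv.next_spec s g hG
  have h2 := hG.pos_inj
  have h3 := hG.pos_le
  have h5 := hG.tail_pos
  have h6 := hG.next_of_lt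
  have h7 := hG.next_of_eq
  have f1 := @TailSeen.pos s g
  have f2 := @TailSeen.pos_le s g
  cases T
  · cases h
    case teLink_success k r t hx => exact hL.link hG hx
    all_goals
      (try rename ECall => k; cases k) <;> (try rename DCall => k; cases k) <;>
      simp only [Undisturbed, CtlInv, Ghost.next, ECall.done, ECall.failed, DCall.done,
        DCall.failed, Shared.setValue, Shared.setNext, Shared.setFlag, Shared.setLoc,
        Shared.casTail] at hc hL ⊢ <;>
      grind
  · cases h <;> (try rename ECall => k; cases k) <;> (try rename DCall => k; cases k) <;>
      simp only [Undisturbed, CtlInv, Ghost.next, ECall.done, ECall.failed, DCall.done,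
        DCall.failed, Shared.setLoc, Shared.casTail] at hc hL ⊢ <;>
      grind

theorem NearlyUndisturbed.step (hG : MemInv s g) (hL : CtlInv s g c) (h : LocalStep s c act s' c')
    (hc : NearlyUndisturbed T s g c) : NearlyUndisturbed T s' (g.next s c) c' := by
  have key := @MemInv.next_spec s g hG
  have h2 := hG.pos_inj
  have h3 := hG.pos_le
  have h4 := hG.len_le
  have h5 := hG.tail_pos
  have h6 := hG.next_of_lt
  have h7 := hG.next_of_eq
  have f1 := @TailSeen.pos s g
  have f2 := @TailSeen.pos_le s g
  cases T
  · cases h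
    case teLink_success k r t hx => exact hL.link hG hx
    all_goals
      (try rename ECall => k; cases k) <;> (try rename DCall => k; cases k) <;>
      simp only [NearlyUndisturbed, CtlInv, Ghost.next, ECall.done, ECall.failed, DCall.done,
        DCall.failed, Shared.casTail] at hc hL ⊢ <;>
      grind
  · cases c' <;> trivial

theorem Undisturbed.of_wins (hG : MemInv s g) (hL : CtlInv s g c) (h : LocalStep s c act s' c')
    (hw : Wins T s c x) : Undisturbed T s' (g.next s c) c' := by
  cases T
  · cases h <;> simp only [Wins] at hw
    · exact hL.link hG hw.2
    · exact absurd hw.2 ‹_›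
  · cases h <;> simp only [Wins] at hw <;> rename DCall => k <;> cases k <;>
      first | trivial | exact absurd hw.2 ‹_›

theorem NearlyUndisturbed.of_announce (h : LocalStep s (announceCtl T x) act s' c') :
    NearlyUndisturbed T s' g' c' := by
  cases T <;> cases h <;> trivial

/-- An announcement follows a failure, which in the absence of other winners has just brought
`Tail` up to date. -/
theorem Undisturbed.of_announce (hc : NearlyUndisturbed T s g (announceCtl T x))
    (h : LocalStep s (announceCtl T x) act s' c') :
    Undisturbed T s' (g.next s (announceCtl T x)) c' := by
  cases T <;> cases h
  · exact hc
  · trivial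

theorem Undisturbed.not_announce (hc : Undisturbed T s g (announceCtl T x)) : False := by
  cases T <;> exact hc

theorem Trapped.of_alloc (h : LocalStep s c act s' c') (hc : rank T c = 30) :
    Trapped B T c' := by
  cases T <;> cases h <;> (try rename ECall => k; cases k) <;> (try rename DCall => k; cases k) <;>
    simp_all [rank, ECall.base, DCall.base, Trapped]

theorem Trapped.not_alloc (hc : Trapped B T c) : rank T c ≠ 30 := by
  cases T <;> cases c <;> (try rename ECall => k; cases k) <;> (try rename DCall => k; cases k) <;>
    simp_all [rank, ECall.base, DCall.base, Trapped]

/-- A process that serves an unsettled token, undisturbed, can only leave the altruistic phase by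
making this token win. -/
theorem Trapped.step (hG : MemInv s g) (hL : CtlInv s g c) (h : LocalStep s c act s' c')
    (hg : Undisturbed T s g c) (hB : ∀ x, B x → Ready T g x → ¬ Settled T s x)
    (hw : ∀ x, B x → ¬ Wins T s c x) (ha : B (ann T s)) (hc : Trapped B T c) :
    Trapped B T c' := by
  have h7 := hG.next_of_eq
  have f1 := @TailSeen.pos s g
  have f2 := @TailSeen.ready s g
  cases T
  · cases h <;> (try rename ECall => k; cases k) <;> (try rename DCall => k; cases k) <;>
      simp only [Trapped, Undisturbed, CtlInv, Ready, Settled, Wins, ann, ECall.done,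
        ECall.failed, DCall.done, DCall.failed] at hc hL hg hB hw ha ⊢ <;>
      grind
  · cases h <;> (try rename ECall => k; cases k) <;> (try rename DCall => k; cases k) <;>
      simp only [Trapped, Undisturbed, CtlInv, Ready, Settled, Wins, ann, ECall.done,
        ECall.failed, DCall.done, DCall.failed] at hc hL hg hB hw ha ⊢ <;>
      grind
end

/-! ### Operations that do not terminate -/

/-- A sequence of natural numbers that is eventually nonincreasing is eventually constant. -/
theorem exists_forall_eq_of_le {f : ℕ → ℕ} {N : ℕ} (hf : ∀ i ≥ N, f (i + 1) ≤ f i) :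
    ∃ M ≥ N, ∀ i ≥ M, f (i + 1) = f i := by
  obtain ⟨M, hM, hmin⟩ := Nat.sInf_mem (s := f '' Set.Ici N) ⟨_, N, Set.self_mem_Ici, rfl⟩
  have hle : ∀ i ≥ M, f i ≤ f M := fun i hi =>
    Nat.le_induction le_rfl (fun k hk ih => (hf k (le_trans hM hk)).trans ih) i hi
  have hge : ∀ i ≥ M, f M ≤ f i := fun i hi =>
    hmin ▸ Nat.sInf_le ⟨i, le_trans hM hi, rfl⟩
  exact ⟨M, hM, fun i hi => by
    have := hle i hi; have := hge i hi
    have := hle (i + 1) (by omega); have := hge (i + 1) (by omega)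
    omega⟩

namespace Execution
variable {n : ℕ} (e : Execution (queue n)) {T : OpType} {N i j : ℕ} {p q : Fin n} {x : ℕ}

/-- A process that completes finitely many operations of type `T` is eventually never in the
altruistic phase of one. -/
theorem exists_not_early (hfin : {i | e.CompletesAt p T i}.Finite) :
    ∃ N, ∀ i ≥ N, e.proc i = p → ¬ Early T (e.ctl i p) := by
  obtain ⟨N, hN⟩ := hfin.bddAbove
  have hcomp : ∀ i ≥ N + 1, e.proc i = p → ∀ y, e.act i ≠ .complete T y := fun i hi hp y hy =>
    absurd (hN ⟨hp, y, hy⟩) (by omega)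
  obtain ⟨M, hM, hconst⟩ := exists_forall_eq_of_le (f := fun i => rank T (e.ctl i p) - 29)
    (N := N + 1) (by
      intro i hi
      by_cases hp : p = e.proc i
      · have := early_step (e.localStep i) (hcomp i hi hp.symm)
        rwa [← hp] at this
      · simp only [e.ctl_of_ne hp, le_refl])
  refine ⟨M, fun i hi hp hearly => ?_⟩
  subst hp
  have h1 := hconst i hi
  have h2 := rank_step (e.localStep i) hearly.2 (hcomp i (le_trans hM hi) rfl)
    (fun x hx => by
      rw [hx] at hearly
      cases T <;> exact absurd hearly.1 (by simp [rank, announceCtl]))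
    (e.not_hangs i _)
  have h3 := hearly.1
  omega

/-- A process that is stuck in an operation announces its token infinitely often. -/
theorem StuckIn.exists_announce (h : e.StuckIn p T) (N : ℕ) :
    ∃ j ≥ N, ∃ x, e.AnnouncesAt T p j x := by
  obtain ⟨i, ⟨hi, y, hy⟩, hinf, hcomp⟩ := h
  by_contra! hno
  have hcomp' : ∀ j > i, p = e.proc j → ∀ y, e.act j ≠ .complete T y := fun j hj hp y hy =>
    hcomp j hj ⟨hp.symm, y, hy⟩
  have hpend : ∀ j ≥ i + 1, rank T (e.ctl j p) < 70 := by
    refine fun j hj => Nat.le_induction ?_ (fun k hk ih => ?_) j hj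
    · subst hi
      exact rank_lt_of_invoke (e.localStep i) hy
    · by_cases hp : p = e.proc k
      · have := early_step (e.localStep k) (hcomp' k hk hp)
        rw [← hp] at this
        omega
      · rwa [e.ctl_of_ne hp]
  have hlt : ∀ j ≥ max N (i + 1), p = e.proc j →
      rank T (e.ctl (j + 1) p) < rank T (e.ctl j p) := by
    intro j hj hp
    have hj1 : N ≤ j := le_trans (le_max_left _ _) hj
    have hj2 : i + 1 ≤ j := le_trans (le_max_right _ _) hj
    have h1 := hpend j hj2
    have h2 := hno j hj1
    have h3 := hcomp' j hj2 hp
    subst hp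
    exact rank_step (e.localStep j) h1 h3 (fun x hx => h2 x ⟨rfl, hx⟩) (e.not_hangs j _)
  obtain ⟨M, hM, hconst⟩ := exists_forall_eq_of_le (f := fun j => rank T (e.ctl j p))
    (N := max N (i + 1)) (by
      intro j hj
      by_cases hp : p = e.proc j
      · exact (hlt j hj hp).le
      · simp only [e.ctl_of_ne hp, le_refl])
  obtain ⟨j, hj, hjM⟩ := hinf.exists_gt M
  exact absurd (hconst j hjM.le) (hlt j (hM.trans hjM.le) (Eq.symm hj)).ne

/-! ### A single winner -/

/-- From step `N` on, all wins of tokens of type `T` are steps of `q`. -/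
def OnlyWinner (T : OpType) (N : ℕ) (q : Fin n) : Prop :=
  ∀ i ≥ N, ∀ x, e.WinsAt T i x → e.proc i = q

variable {e}

theorem OnlyWinner.noWin (h : e.OnlyWinner T N q) (hi : N ≤ i) (hq : q ≠ e.proc i) :
    NoWin T (e.mem i) (e.ghost i) (e.mem (i + 1)) (e.ghost (i + 1)) :=
  .of_step (e.localStep i) fun x hx => hq (h i hi x hx).symm

theorem OnlyWinner.undisturbed (h : e.OnlyWinner T N q) (hi : N ≤ i)
    (hg : Undisturbed T (e.mem i) (e.ghost i) (e.ctl i q)) (hij : i ≤ j) :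
    Undisturbed T (e.mem j) (e.ghost j) (e.ctl j q) := by
  refine Nat.le_induction hg (fun k hk ih => ?_) j hij
  by_cases hq : q = e.proc k
  · subst hq
    exact ih.step (e.memInv k) (e.ctlInv k _) (e.localStep k)
  · rw [e.ctl_of_ne hq]
    exact ih.mono (e.memInv (k + 1)) (e.evolves k) (h.noWin (hi.trans hk) hq)

theorem OnlyWinner.nearlyUndisturbed (h : e.OnlyWinner T N q) (hi : N ≤ i)
    (hg : NearlyUndisturbed T (e.mem i) (e.ghost i) (e.ctl i q)) (hij : i ≤ j) :
    NearlyUndisturbed T (e.mem j) (e.ghost j) (e.ctl j q) := by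
  refine Nat.le_induction hg (fun k hk ih => ?_) j hij
  by_cases hq : q = e.proc k
  · subst hq
    exact ih.step (e.memInv k) (e.ctlInv k _) (e.localStep k)
  · rw [e.ctl_of_ne hq]
    exact ih.mono (e.memInv (k + 1)) (e.evolves k) (h.noWin (hi.trans hk) hq)

/-- A process that is eventually the only winner announces finitely often. -/
theorem OnlyWinner.not_announces_often (h : e.OnlyWinner T N q) :
    ¬ ∀ M, ∃ j ≥ M, ∃ x, e.AnnouncesAt T q j x := by
  intro hinf
  obtain ⟨j₁, hj₁, x₁, rfl, h₁⟩ := hinf N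
  have hs := e.localStep j₁
  rw [h₁] at hs
  have hw := NearlyUndisturbed.of_announce (g' := e.ghost (j₁ + 1)) hs
  obtain ⟨j₂, hj₂, x₂, hp₂, h₂⟩ := hinf (j₁ + 1)
  have hw₂ := h.nearlyUndisturbed (by omega) hw hj₂
  have hs₂ := e.localStep j₂
  rw [hp₂, h₂] at hs₂
  rw [h₂] at hw₂
  have hg := Undisturbed.of_announce hw₂ hs₂
  obtain ⟨j₃, hj₃, x₃, hp₃, h₃⟩ := hinf (j₂ + 1)
  have hg' : Undisturbed T (e.mem (j₂ + 1)) (e.ghost (j₂ + 1)) (e.ctl (j₂ + 1) (e.proc j₁)) := by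
    rw [ghost, hp₂, h₂]
    exact hg
  have := h.undisturbed (by omega) hg' hj₃
  rw [h₃] at this
  exact this.not_announce

/-! ### The other processes -/

variable (e) in
/-- From `N` on, no process but `q` is in the altruistic phase of an operation of type `T`. -/
def SelfishExcept (T : OpType) (N : ℕ) (q : Fin n) : Prop :=
  ∀ i ≥ N, e.proc i ≠ q → ¬ Early T (e.ctl i (e.proc i))

/-- Without an allocation a process does not get a new token. -/
theorem SelfishExcept.own_eq (h : e.SelfishExcept T N q) (hp : p ≠ q) (hi : N ≤ i) (hij : i ≤ j)
    (hx : own T (e.ctl j p) = some x) : own T (e.ctl i p) = some x := by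
  induction j, hij using Nat.le_induction with
  | base => exact hx
  | succ k hk ih =>
    apply ih
    by_cases hpk : p = e.proc k
    · subst hpk
      exact (own_step (e.localStep k) hx).resolve_right fun h' => h k (hi.trans hk) hp h'.1
    · rwa [e.ctl_of_ne hpk] at hx

theorem AnnouncesAt.own_eq (h : e.AnnouncesAt T p i x) : own T (e.ctl i p) = some x := by
  rw [h.2, own_announceCtl]

variable (e) in
/-- The token `x` is announced infinitely often by a process other than `q`. -/
def Persistent (T : OpType) (q : Fin n) (x : ℕ) : Prop :=
  ∃ p ≠ q, ∀ M, ∃ j ≥ M, e.AnnouncesAt T p j x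

theorem SelfishExcept.mem_used_of_persistent (h : e.SelfishExcept T N q) (hx : e.Persistent T q x) :
    x ∈ used T (e.mem N) := by
  obtain ⟨p, hp, hinf⟩ := hx
  obtain ⟨j, hj, hjx⟩ := hinf N
  exact e.own_mem_used (h.own_eq hp le_rfl hj hjx.own_eq)

/-- The owner of a settled token returns without announcing it more than once again. -/
theorem SelfishExcept.not_settled_of_persistent (h : e.SelfishExcept T N q)
    (hx : e.Persistent T q x) (hr : Ready T (e.ghost i) x) : ¬ Settled T (e.mem i) x := by
  intro hs
  obtain ⟨p, hp, hinf⟩ := hx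
  have hown : ∀ j ≥ N, own T (e.ctl j p) = some x := fun j hj => by
    obtain ⟨k, hk, hkx⟩ := hinf j
    exact h.own_eq hp hj hk hkx.own_eq
  have hlt : ∀ j ≥ max N i, p = e.proc j →
      settledRank T (e.ctl (j + 1) p) < settledRank T (e.ctl j p) := by
    intro j hj hpj
    have h1 := hown j (le_trans (le_max_left _ _) hj)
    have h2 := e.settled_mono (le_trans (le_max_right _ _) hj) hr hs
    subst hpj
    exact settledRank_step (e.localStep j) h1 h2 (e.not_hangs j _)
  obtain ⟨M, hM, hconst⟩ := exists_forall_eq_of_le (f := fun j => settledRank T (e.ctl j p))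
    (N := max N i) (by
      intro j hj
      by_cases hpj : p = e.proc j
      · exact (hlt j hj hpj).le
      · simp only [e.ctl_of_ne hpj, le_refl])
  obtain ⟨j, hj, hjx⟩ := hinf M
  exact absurd (hconst j hj) (hlt j (hM.trans hj) hjx.1.symm).ne

/-- Processes that announce finitely often eventually stop, and the others, as they do not allocate,
announce the same token over and over. -/
theorem SelfishExcept.exists_forall_persistent (h : e.SelfishExcept T N q) :
    ∃ M, ∀ p ≠ q, ∀ j ≥ M, ∀ x, e.AnnouncesAt T p j x → e.Persistent T q x := by
  have key : ∀ p, ∃ M, p ≠ q → ∀ j ≥ M, ∀ x, e.AnnouncesAt T p j x → e.Persistent T q x := by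
    intro p
    by_cases hinf : ∀ M, ∃ j ≥ M, ∃ x, e.AnnouncesAt T p j x
    · refine ⟨N, fun hp j hj x hx => ⟨p, hp, fun M => ?_⟩⟩
      obtain ⟨k, hk, y, hy⟩ := hinf (max M N)
      have h1 := h.own_eq hp le_rfl hj hx.own_eq
      have h2 := h.own_eq hp le_rfl (le_trans (le_max_right _ _) hk) hy.own_eq
      obtain rfl : x = y := by simpa [h1] using h2
      exact ⟨k, le_trans (le_max_left _ _) hk, hy⟩
    · push Not at hinf
      obtain ⟨M, hM⟩ := hinf
      exact ⟨M, fun _ j hj x hx => absurd hx (hM j hj x)⟩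
  choose M hM using key
  exact ⟨Finset.univ.sup M, fun p hp j hj =>
    hM p hp j (le_trans (Finset.le_sup (Finset.mem_univ p)) hj)⟩

/-- If some process is stuck, then no single process `q` is alone in completing infinitely many
operations. -/
theorem exists_two_of_stuck (h : e.StuckIn p T) (q : Fin n) :
    ∃ r ≠ q, {i | e.CompletesAt r T i}.Infinite := by
  by_contra! hfin
  obtain ⟨N, hN⟩ : ∃ N, e.SelfishExcept T N q := by
    have key : ∀ r, ∃ M, r ≠ q → ∀ i ≥ M, e.proc i = r → ¬ Early T (e.ctl i r) := fun r => by
      by_cases hr : r = q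
      · exact ⟨0, fun h => absurd hr h⟩
      · exact (e.exists_not_early (hfin r hr)).imp fun M hM _ => hM
    choose M hM using key
    exact ⟨Finset.univ.sup M, fun i hi hp =>
      hM _ hp i (le_trans (Finset.le_sup (Finset.mem_univ _)) hi) rfl⟩
  -- After `N` only `q` allocates, so a winner other than `q` would be a token in use at `N`.
  obtain ⟨N₁, hN₁⟩ := e.finite_wins T (used T (e.mem N))
  have honly : e.OnlyWinner T (max N N₁) q := by
    intro i hi x hx
    by_contra hq
    have hiN := le_trans (le_max_left _ _) hi
    obtain h1 | h1 := hx.own_or_early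
    · exact hN₁ i (le_trans (le_max_right _ _) hi) x
        (e.own_mem_used (hN.own_eq hq le_rfl hiN h1)) hx
    · exact hN i hiN hq h1
  have hinf : ∀ M, ∃ i ≥ M, ∃ x, e.WinsAt T i x := by
    intro M
    by_contra! hno
    -- Without wins, every process is vacuously the only winner; in particular `p` is.
    exact OnlyWinner.not_announces_often (N := M) (q := p)
      (fun i hi x hx => absurd hx (hno i hi x)) (h.exists_announce e)
  obtain ⟨i₀, hi₀, x₀, hx₀⟩ := hinf (max N N₁)
  -- Having just linked or installed a token, `q` knows the present state of the shared memory.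
  have hgood : ∀ j ≥ i₀ + 1, Undisturbed T (e.mem j) (e.ghost j) (e.ctl j q) := by
    intro j hj
    obtain rfl := honly i₀ hi₀ x₀ hx₀
    refine honly.undisturbed (by omega) ?_ hj
    exact Undisturbed.of_wins (e.memInv i₀) (e.ctlInv i₀ _) (e.localStep i₀) hx₀
  have hquit : ∀ j ≥ i₀ + 1, ∀ x, ¬ e.AnnouncesAt T q j x := fun j hj x hx =>
    (hx.2 ▸ hgood j hj).not_announce
  obtain ⟨N₂, hN₂⟩ := hN.exists_forall_persistent
  have hbad : ∀ j ≥ max (i₀ + 1) N₂, ∀ x, e.AnnouncesAt T (e.proc j) j x → e.Persistent T q x := by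
    intro j hj x hx
    refine hN₂ (e.proc j) (fun hq => ?_) j (le_trans (le_max_right _ _) hj) x hx
    exact hquit j (le_trans (le_max_left _ _) hj) x (hq ▸ hx)
  obtain ⟨j₀, hj₀, y₀, hy₀, hy₀'⟩ := h.exists_announce e (max (i₀ + 1) N₂)
  subst hy₀
  -- The announced token is persistent once `p` has announced again: `q` does not overwrite it.
  have hann : ∀ j ≥ j₀ + 1, e.Persistent T q (ann T (e.mem j)) := by
    refine fun j hj => Nat.le_induction ?_ (fun k hk ih => ?_) j hj
    · obtain h1 | h1 := ann_step (T := T) (e.localStep j₀)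
      · exact hbad j₀ hj₀ _ ⟨rfl, h1⟩
      · exact absurd hy₀' (h1.2 y₀)
    · obtain h1 | h1 := ann_step (T := T) (e.localStep k)
      · exact hbad k (by omega) _ ⟨rfl, h1⟩
      · exact h1.1 ▸ ih
  -- Infinitely many tokens win, so infinitely many are allocated.
  have halloc : ∀ M ≥ N, ∃ j ≥ M, e.proc j = q ∧ rank T (e.ctl j (e.proc j)) = 30 := by
    intro M hM
    by_contra! hno
    have hno' : ∀ j ≥ M, rank T (e.ctl j (e.proc j)) ≠ 30 := fun j hj h30 => by
      by_cases hq : e.proc j = q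
      · exact hno j hj hq h30
      · exact hN j (hM.trans hj) hq (by simp [Early, h30])
    have hused : ∀ j ≥ M, used T (e.mem j) = used T (e.mem M) := fun j hj =>
      Nat.le_induction rfl
        (fun k hk ih => (used_step_eq (e.localStep k) (hno' k hk)).trans ih) j hj
    obtain ⟨K, hK⟩ := e.finite_wins T (used T (e.mem M))
    obtain ⟨i, hi, x, hx⟩ := hinf (max K M)
    exact hK i (le_trans (le_max_left _ _) hi) x
      (hused i (le_trans (le_max_right _ _) hi) ▸ WinsAt.mem_used e hx) hx
  obtain ⟨k, hk, rfl, hk30⟩ := halloc (max N j₀ + 1) (by omega)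
  -- After an allocation by `q`, its next altruistic phase cannot end.
  have htrap : ∀ j ≥ k + 1, Trapped (e.Persistent T (e.proc k)) T (e.ctl j (e.proc k)) := by
    refine fun j hj => Nat.le_induction ?_ (fun l hl ih => ?_) j hj
    · exact .of_alloc (e.localStep k) hk30
    · by_cases hq : e.proc k = e.proc l
      · rw [hq] at ih ⊢
        refine ih.step (e.memInv l) (e.ctlInv l _) (e.localStep l)
          (hq ▸ hgood l (by omega)) ?_ ?_ ?_
        · intro x hx hr
          exact hN.not_settled_of_persistent (hq ▸ hx) hr
        · intro x hx
          exact hN₁ l (by omega) x (hN.mem_used_of_persistent (hq ▸ hx))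
        · exact hq ▸ hann l (by omega)
      · rwa [e.ctl_of_ne hq]
  obtain ⟨l, hl, hlk, hl30⟩ := halloc (k + 1) (by omega)
  exact (hlk ▸ htrap l hl).not_alloc hl30

end Execution

end DNBQueue

theorem mainTheorem2 (n : ℕ) : (DNBQueue.queue n).DNB 2 := by
  rintro e T ⟨p, hp⟩
  obtain ⟨q, -, hq⟩ := DNBQueue.Execution.exists_two_of_stuck hp p
  obtain ⟨r, hr, hr'⟩ := DNBQueue.Execution.exists_two_of_stuck hp q
  refine ⟨{q, r}, ?_, ?_⟩
  · rw [Finset.card_pair hr.symm]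
  · simp only [Finset.mem_insert, Finset.mem_singleton]
    rintro s (rfl | rfl)
    exacts [hq, hr']
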